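/- All graphs are finite and undirected; parallel edges (and loops) are allowed. For a finite set $S$ of vertices, an \emph{$S$-forest} is a graph $B=(U,F)$ with $S\subseteq U$ whose edges can be oriented so that every $u\in U$ is the last vertex of exactly one directed walk starting in $S$ (equivalently, $B$ is a forest each of whose connected components contains exactly one vertex of $S$). For a graph $G=(V,E)$ and $k,h\in\mathbb Z_{>0}$, an \emph{$h$-regular packing of $k$ $S_i$-forests in $G$} is a family $B_1,\dots,B_k$ of pairwise edge-disjoint subgraphs of $G$, where $B_i$ is an $S_i$-forest, such that every vertex of $G$ belongs to exactly $h$ of $B_1,\dots,B_k$. For a partition $\mathcal P$ of $V$ (into nonempty sets), let $e_E(\mathcal P)$ be the number of edges in $E$ whose ends lie in two different members of $\mathcal P$. \textbf{Theorem.} Let $G=(V,E)$ be a graph, $h,k\in\mathbb Z_{>0}$, and let $\ell,\ell':\{0,1,\dots,k\}\to\mathbb Z_{>0}$ satisfy $$\sum_{i=1}^k\ell'(i)\ \ge\ \ell'(0)\ \ge\ \ell(0)\ \ge\ \sum_{i=1}^k\ell(i)\qquad\text{and}\qquad |V|\ge\ell'(i)\ge\ell(i)\quad\text{for every }1\le i\le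 k.$$ There exist vertex sets $S_1,\dots,S_k$ and an $h$-regular packing of $k$ $S_i$-forests $B_i$ in $G$ such that $$\ell(i)\le|S_i|\le\ell'(i)\quad\text{for every }1\le i\le k,\qquad \ell(0)\le\sum_{i=1}^k|S_i|\le\ell'(0),$$ if and only if $h|V|\ge\ell(0)$ and, for every partition $\mathcal P$ of $V$, $$\ell'(0)-\sum_{i=1}^k\ell(i)+\sum_{i=1}^k\min\{\ell(i),|\mathcal P|\}+e_E(\mathcal P)\ \ge\ h|\mathcal P|,$$ $$\sum_{i=1}^k\min\{\ell'(i),|\mathcal P|\}+e_E(\mathcal P)\ \ge\ h|\mathcal P|.$$ -/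

import Mathlib

open scoped Graph

namespace Graph

/-- `tail`, `head` give an orientation of the multigraph `H`: every edge `e` of `H` becomes an arc
from `tail e` to `head e` (values on non-edges are irrelevant). -/
def IsOrientation {α β : Type*} (H : Graph α β) (tail head : β → α) : Prop :=
  ∀ e ∈ E(H), H.IsLink e (tail e) (head e)

/-- `H.IsDiWalk tail head u w v`: the list of edges `w` is a directed walk from `u` to `v` in the
digraph obtained from `H` by orienting every edge `e` from `tail e` to `head e`. -/
inductive IsDiWalk {α β : Type*} (H : Graph α β) (tail head : β → α) : α → List β → α → Prop
  | nil {u : α} (hu : u ∈ V(H)) : IsDiWalk H tail head u [] u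
  | cons {e : β} {w : List β} {v : α} (he : e ∈ E(H))
      (hw : IsDiWalk H tail head (head e) w v) : IsDiWalk H tail head (tail e) (e :: w) v

/-- `H`, oriented by `tail` and `head`, is a branching with root set `S`: the roots are vertices of
`H`, and every vertex of `H` is reached from `S` in exactly one way. Uniqueness is required among
all directed walks (the unique walk is then automatically a path); this forces roots to have
in-degree `0` and all other vertices to have in-degree `1`, so no directed or undirected cycle
exists. -/
def IsBranching {α β : Type*} (H : Graph α β) (tail head : β → α) (S : Finset α) : Prop :=
  (S : Set α) ⊆ V(H) ∧
    ∀ u ∈ V(H), ∃! p : α × List β, p.1 ∈ S ∧ H.IsDiWalk tail head p.1 p.2 u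

/-- `H` is an `S`-forest: its edges can be oriented so that it becomes an `S`-branching. -/
def IsRootedForest {α β : Type*} (H : Graph α β) (S : Finset α) : Prop :=
  ∃ tail head : β → α, H.IsOrientation tail head ∧ H.IsBranching tail head S

/-- The family `B` is an `h`-regular packing in `G` of `k` rooted forests with root sets `S i`:
the `B i` are pairwise edge-disjoint `S i`-forests which are subgraphs of `G`, and every vertex of
`G` belongs to exactly `h` of them. -/
structure IsRegularForestPacking {α β : Type*} (G : Graph α β) (h : ℕ) {k : ℕ}
    (B : Fin k → Graph α β) (S : Fin k → Finset α) : Prop where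
  le : ∀ i, B i ≤ G
  isRootedForest : ∀ i, (B i).IsRootedForest (S i)
  edgeDisjoint : ∀ i j, i ≠ j → Disjoint E(B i) E(B j)
  regular : ∀ v ∈ V(G), {i : Fin k | v ∈ V(B i)}.ncard = h

/-- `e_E(P)`: the number of edges of `G` that enter some member of the partition `P` of `V(G)`,
that is, have exactly one end in some member of `P`. -/
noncomputable def numCrossing {α β : Type*} (G : Graph α β) (P : Partition V(G)) : ℕ :=
  {e : β | ∃ X ∈ P.parts, ∃ x y, G.IsLink e x y ∧ x ∈ X ∧ y ∉ X}.ncard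

end Graph

/-!
Necessity: in an `S i`-forest, every part of `P` that meets it contains a root or is entered by one
of its arcs, so it meets at most `#(S i)` parts plus the number of its crossing edges, while every
part is met by at least `h` of the forests.

Sufficiency: first choose the numbers of roots `s i` between `l i` and `l' i` so that they add up
to the largest admissible value while `h |P| ≤ ∑ i, min (s i) |P| + e(P)` holds for every partition
`P`. Adjoin to the edges a coloured root `(v, i)` for every vertex `v` and every index `i`. The
sets in which, for every nonempty vertex set `X` and every set `D` of colours, at most
`h (|X| - 1) + min h |D|` elements are supported in `X` and have their colours in `D` are the
independent sets of a matroid, whose rank function is a minimum over partitions. Rado's theorem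
then turns the inequalities for `s` into an independent set of `h |V|` elements containing exactly
`s i` roots of each colour `i`. By Hall's theorem its elements can be assigned to vertices in their
supports, `h` to each vertex. This orients the chosen edges, and independence becomes Edmonds' cut
condition, which lets the branchings grow arc by arc until every vertex lies in `h` of them.
-/

namespace ForestPacking

open Finset

section Rado

variable {ι Ω : Type*} {M : Matroid Ω}

/-- Rado's condition for an independent transversal of the family `A` in the matroid `M`. -/
def RadoCondition (M : Matroid Ω) (A : ι → Finset Ω) : Prop :=
  ∀ J : Finset ι, (#J : ℕ∞) ≤ M.eRk (⋃ j ∈ J, A j)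

lemma RadoCondition.mem_of_eRk_update_lt [DecidableEq ι] {A : ι → Finset Ω}
    (hA : RadoCondition M A) {i : ι} {B : Finset Ω} {J : Finset ι}
    (hJ : M.eRk (⋃ j ∈ J, Function.update A i B j) < #J) : i ∈ J := by
  by_contra hi
  refine (hA J).not_gt ((congrArg M.eRk ?_).trans_lt hJ)
  exact Set.iUnion₂_congr fun j hj ↦ by
    rw [Function.update_of_ne (ne_of_mem_of_not_mem hj hi)]

lemma RadoCondition.update_erase_or [DecidableEq ι] [DecidableEq Ω] {A : ι → Finset Ω}
    (hA : RadoCondition M A) (i : ι) {x y : Ω} (hxy : x ≠ y) :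
    RadoCondition M (Function.update A i ((A i).erase x)) ∨
      RadoCondition M (Function.update A i ((A i).erase y)) := by
  by_contra! hcon
  simp only [RadoCondition, not_forall, not_le] at hcon
  obtain ⟨⟨J, hJ⟩, K, hK⟩ := hcon
  have hiJ := hA.mem_of_eRk_update_lt hJ
  have hiK := hA.mem_of_eRk_update_lt hK
  have mem_update {L : Finset ι} {j : ι} {w z : Ω} (hj : j ∈ L) (hz : z ∈ A j)
      (hne : j ≠ i ∨ z ≠ w) :
      z ∈ ⋃ j ∈ L, (Function.update A i ((A i).erase w) j : Set Ω) := by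
    refine Set.mem_biUnion hj ?_
    obtain rfl | hji := eq_or_ne j i <;> simp_all
  set U : Set Ω := ⋃ j ∈ J, Function.update A i ((A i).erase x) j
  set W : Set Ω := ⋃ j ∈ K, Function.update A i ((A i).erase y) j
  have hunion : (⋃ j ∈ J ∪ K, (A j : Set Ω)) ⊆ U ∪ W := by
    refine Set.iUnion₂_subset fun j hj z hz ↦ ?_
    obtain rfl | hji := eq_or_ne j i
    · obtain rfl | hzx := eq_or_ne z x
      exacts [.inr (mem_update hiK hz (.inr hxy)), .inl (mem_update hiJ hz (.inr hzx))]
    · exact (mem_union.1 hj).imp (mem_update · hz (.inl hji)) (mem_update · hz (.inl hji))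
  have hinter : (⋃ j ∈ (J ∩ K).erase i, (A j : Set Ω)) ⊆ U ∩ W := by
    refine Set.iUnion₂_subset fun j hj z hz ↦ ?_
    obtain ⟨hji, hj⟩ := mem_erase.1 hj
    obtain ⟨hjJ, hjK⟩ := mem_inter.1 hj
    exact ⟨mem_update hjJ hz (.inl hji), mem_update hjK hz (.inl hji)⟩
  have hcard : (#((J ∩ K).erase i) + #(J ∪ K) + 2 : ℕ∞) ≤ #J + #K :=
    calc (#((J ∩ K).erase i) + #(J ∪ K) + 2 : ℕ∞)
        ≤ M.eRk (U ∩ W) + M.eRk (U ∪ W) + 2 := by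
          gcongr
          exacts [(hA _).trans (M.eRk_mono hinter), (hA _).trans (M.eRk_mono hunion)]
      _ ≤ M.eRk U + M.eRk W + 2 := by grw [M.eRk_inter_add_eRk_union_le U W]
      _ = (M.eRk U + 1) + (M.eRk W + 1) := by ring
      _ ≤ #J + #K := add_le_add (Order.add_one_le_of_lt hJ) (Order.add_one_le_of_lt hK)
  have herase := card_erase_add_one (mem_inter.2 ⟨hiJ, hiK⟩)
  have hsum := card_union_add_card_inter J K
  norm_cast at hcard
  omega

lemma RadoCondition.indep_of_singletons [Finite ι] {f : ι → Ω}
    (hf : RadoCondition M fun i ↦ {f i}) : f.Injective ∧ M.Indep (Set.range f) := by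
  classical
  have := Fintype.ofFinite ι
  have hrk : (Fintype.card ι : ℕ∞) ≤ M.eRk (univ.image f : Finset Ω) := by
    simpa [Set.iUnion_singleton_eq_range] using hf univ
  have hle : #(univ.image f) ≤ Fintype.card ι := card_image_le
  have hcard : #(univ.image f) = Fintype.card ι :=
    hle.antisymm <| Nat.cast_le.1 <| hrk.trans <|
      (M.eRk_le_encard _).trans_eq (Set.encard_coe_eq_coe_finsetCard _)
  refine ⟨?_, ?_⟩
  · simpa using card_image_iff.1 hcard
  · have hindep : M.Indep (univ.image f : Finset Ω) :=
      (M.indep_iff_eRk_eq_encard_of_finite (finite_toSet _)).2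
        ((M.eRk_le_encard _).antisymm (by rwa [Set.encard_coe_eq_coe_finsetCard, hcard]))
    simpa using hindep

/-- Rado's theorem. -/
theorem RadoCondition.exists_injective_indep [Finite ι] {A : ι → Finset Ω}
    (hA : RadoCondition M A) :
    ∃ f : ι → Ω, f.Injective ∧ M.Indep (Set.range f) ∧ ∀ i, f i ∈ A i := by
  classical
  have := Fintype.ofFinite ι
  induction hn : ∑ i, #(A i) using Nat.strong_induction_on generalizing A with
  | _ n ih =>
  by_cases hlarge : ∃ i, 1 < #(A i)
  · obtain ⟨i, hi⟩ := hlarge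
    have shrink {z : Ω} (hz : z ∈ A i)
        (hA' : RadoCondition M (Function.update A i ((A i).erase z))) :
        ∃ f : ι → Ω, f.Injective ∧ M.Indep (Set.range f) ∧ ∀ i, f i ∈ A i := by
      have hle (j : ι) : Function.update A i ((A i).erase z) j ⊆ A j := by
        obtain rfl | hji := eq_or_ne j i
        · simpa using erase_subset z (A j)
        · rw [Function.update_of_ne hji]
      have hlt : ∑ j, #(Function.update A i ((A i).erase z) j) < n :=
        hn ▸ sum_lt_sum (fun j _ ↦ card_le_card (hle j))
          ⟨i, mem_univ i, by simpa using card_erase_lt_of_mem hz⟩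
      obtain ⟨f, hinj, hind, hf⟩ := ih _ hlt hA' rfl
      exact ⟨f, hinj, hind, fun j ↦ hle j (hf j)⟩
    obtain ⟨x, hx, y, hy, hxy⟩ := one_lt_card.1 hi
    exact (hA.update_erase_or i hxy).elim (shrink hx) (shrink hy)
  · have hne (i : ι) : (A i).Nonempty := by
      rw [nonempty_iff_ne_empty]
      intro hempty
      simpa [hempty] using hA {i}
    push Not at hlarge
    choose f hf using fun i ↦ card_eq_one.1 ((hlarge i).antisymm (hne i).card_pos)
    obtain rfl : A = fun i ↦ {f i} := funext hf
    obtain ⟨hinj, hind⟩ := hA.indep_of_singletons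
    exact ⟨f, hinj, hind, fun i ↦ mem_singleton_self _⟩

/-- Rado's theorem applied to `cap i` copies of each fibre of `c`. -/
theorem exists_indep_card_fiber_eq [Finite ι] [DecidableEq ι] [Finite Ω] {c : Ω → ι}
    {cap : ι → ℕ}
    (hcap : ∀ C : Finset ι, (∑ i ∈ C, cap i : ℕ) ≤ M.eRk {x | c x ∈ C}) :
    ∃ I : Finset Ω, M.Indep I ∧ ∀ i, #{x ∈ I | c x = i} = cap i := by
  classical
  have := Fintype.ofFinite ι
  have := Fintype.ofFinite Ω
  have hRado : RadoCondition M fun p : Σ i, Fin (cap i) ↦ ({x | c x = p.1} : Finset Ω) := by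
    intro J
    have hJ : #J ≤ ∑ i ∈ J.image Sigma.fst, cap i :=
      calc #J ≤ #((J.image Sigma.fst).sigma fun i ↦ (univ : Finset (Fin (cap i)))) :=
            card_le_card fun p hp ↦ mem_sigma.2 ⟨mem_image_of_mem _ hp, mem_univ _⟩
        _ = ∑ i ∈ J.image Sigma.fst, cap i := by simp
    refine (Nat.cast_le.2 hJ).trans ((hcap _).trans_eq ?_)
    congr 1
    ext x
    simp
  obtain ⟨f, hinj, hind, hf⟩ := hRado.exists_injective_indep
  refine ⟨univ.image f, by simpa using hind, fun i ↦ ?_⟩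
  have hfiber : {x ∈ univ.image f | c x = i} = univ.image fun a : Fin (cap i) ↦ f ⟨i, a⟩ := by
    have hc (p) : c (f p) = p.1 := by simpa using hf p
    ext x
    simp only [mem_filter, mem_image, mem_univ, true_and]
    constructor
    · rintro ⟨⟨⟨j, a⟩, rfl⟩, hx⟩
      obtain rfl : j = i := (hc _).symm.trans hx
      exact ⟨a, rfl⟩
    · rintro ⟨a, rfl⟩
      exact ⟨⟨⟨i, a⟩, rfl⟩, hc _⟩
  have hinj_i : Function.Injective fun a : Fin (cap i) ↦ f ⟨i, a⟩ := hinj.comp sigma_mk_injective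
  rw [hfiber, card_image_of_injective _ hinj_i, card_univ, Fintype.card_fin]

end Rado

section CountMatroid

variable {V Ω κ : Type*} [DecidableEq κ] {supp : Ω → Finset V} {col : Ω → Finset κ} {h : ℕ}
  {I J : Finset Ω}

/-- Independence in the count matroid of a coloured hypergraph: a set `T` of elements supported in
a nonempty vertex set `X` and carrying `c` colours has at most `h (|X| - 1) + min h c` elements.
(The term `h` is moved to the left to avoid the truncated subtraction.) -/
def CountIndep (supp : Ω → Finset V) (col : Ω → Finset κ) (h : ℕ) (I : Finset Ω) : Prop :=
  ∀ X : Finset V, X.Nonempty → ∀ T ⊆ I, (∀ x ∈ T, supp x ⊆ X) →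
    #T + h ≤ h * #X + min h #(T.biUnion col)

lemma countIndep_empty : CountIndep supp col h ∅ := fun X hX T hT _ ↦ by
  rw [subset_empty.1 hT]
  simpa using Nat.le_mul_of_pos_right h hX.card_pos

lemma CountIndep.subset (hJ : CountIndep supp col h J) (hIJ : I ⊆ J) : CountIndep supp col h I :=
  fun X hX T hT ↦ hJ X hX T (hT.trans hIJ)

lemma min_card_union_add_min_card_inter_le (h : ℕ) (A B : Finset κ) :
    min h #(A ∪ B) + min h #(A ∩ B) ≤ min h #A + min h #B := by
  have := card_union_add_card_inter A B
  have := card_le_card (subset_union_left (s₁ := A) (s₂ := B))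
  have := card_le_card (subset_union_right (s₁ := A) (s₂ := B))
  omega

/-- A partition of the vertex set, every part `p.1` of which comes with a set `p.2` of elements
supported in it. -/
structure IsSupportedPartition (supp : Ω → Finset V) (P : Finset (Finset V × Finset Ω)) :
    Prop where
  nonempty : ∀ p ∈ P, p.1.Nonempty
  supp_subset : ∀ p ∈ P, ∀ x ∈ p.2, supp x ⊆ p.1
  pairwiseDisjoint : (P : Set (Finset V × Finset Ω)).PairwiseDisjoint Prod.fst
  exists_mem : ∀ v, ∃ p ∈ P, v ∈ p.1

lemma IsSupportedPartition.eq_of_mem {P : Finset (Finset V × Finset Ω)}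
    (hP : IsSupportedPartition supp P) {p q : Finset V × Finset Ω} (hp : p ∈ P) (hq : q ∈ P) {v : V}
    (hvp : v ∈ p.1) (hvq : v ∈ q.1) : p = q :=
  hP.pairwiseDisjoint.elim_finset hp hq v hvp hvq

lemma IsSupportedPartition.sum_card [Fintype V] {P : Finset (Finset V × Finset Ω)}
    (hP : IsSupportedPartition supp P) : ∑ p ∈ P, #p.1 = Fintype.card V := by
  classical
  rw [← card_biUnion hP.pairwiseDisjoint, ← card_univ,
    eq_univ_of_forall fun v ↦ mem_biUnion.2 (hP.exists_mem v)]

lemma IsSupportedPartition.pairwiseDisjoint_snd {P : Finset (Finset V × Finset Ω)}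
    (hP : IsSupportedPartition supp P) (hs : ∀ x, (supp x).Nonempty) :
    (P : Set (Finset V × Finset Ω)).PairwiseDisjoint Prod.snd := by
  refine fun p hp q hq hpq ↦ disjoint_left.2 fun x hxp hxq ↦ hpq ?_
  obtain ⟨v, hv⟩ := hs x
  exact hP.eq_of_mem hp hq (hP.supp_subset p hp x hxp hv) (hP.supp_subset q hq x hxq hv)

variable [DecidableEq Ω]

lemma CountIndep.card_add_mul_card_le [Fintype V] (hJ : CountIndep supp col h J)
    {P : Finset (Finset V × Finset Ω)} (hP : IsSupportedPartition supp P) :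
    #J + h * #P ≤
      h * Fintype.card V + ∑ p ∈ P, min h #(p.2.biUnion col) + #(J \ P.biUnion Prod.snd) := by
  have hinside : #(J ∩ P.biUnion Prod.snd) ≤ ∑ p ∈ P, #(p.2 ∩ J) := by
    rw [inter_comm, biUnion_inter]
    exact card_biUnion_le
  have hsum : ∑ p ∈ P, #(p.2 ∩ J) + h * #P ≤
      h * Fintype.card V + ∑ p ∈ P, min h #(p.2.biUnion col) :=
    calc ∑ p ∈ P, #(p.2 ∩ J) + h * #P = ∑ p ∈ P, (#(p.2 ∩ J) + h) := by
          rw [sum_add_distrib, sum_const, smul_eq_mul, mul_comm h]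
      _ ≤ ∑ p ∈ P, (h * #p.1 + min h #(p.2.biUnion col)) := by
          refine sum_le_sum fun p hp ↦ ?_
          grw [hJ p.1 (hP.nonempty p hp) (p.2 ∩ J) inter_subset_right fun x hx ↦
            hP.supp_subset p hp x (inter_subset_left hx), inter_subset_left (s₁ := p.2)]
      _ = h * Fintype.card V + ∑ p ∈ P, min h #(p.2.biUnion col) := by
          rw [sum_add_distrib, ← mul_sum, hP.sum_card]
  have hsplit := card_inter_add_card_sdiff J (P.biUnion Prod.snd)
  omega

/-- A pair of a vertex set and a set of elements supported in it for which `I` attains the bound of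
`CountIndep`. -/
structure IsTight (supp : Ω → Finset V) (col : Ω → Finset κ) (h : ℕ) (I : Finset Ω)
    (p : Finset V × Finset Ω) : Prop where
  supp_subset : ∀ x ∈ p.2, supp x ⊆ p.1
  le : h * #p.1 + min h #(p.2.biUnion col) ≤ #(p.2 ∩ I) + h

lemma isTight_singleton (supp : Ω → Finset V) (col : Ω → Finset κ) (h : ℕ) (I : Finset Ω) (v : V) :
    IsTight supp col h I ({v}, ∅) := ⟨by simp, by simp⟩

lemma CountIndep.exists_isTight_of_insert (hI : CountIndep supp col h I) {x : Ω}
    (hdep : ¬ CountIndep supp col h (insert x I)) :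
    ∃ p, IsTight supp col h I p ∧ p.1.Nonempty ∧ x ∈ p.2 := by
  simp only [CountIndep, not_forall, not_le] at hdep
  obtain ⟨X, hX, T, hTI, hTX, hlt⟩ := hdep
  have hxT : x ∈ T := by
    by_contra hxT
    exact hlt.not_ge (hI X hX T ((subset_insert_iff_of_notMem hxT).1 hTI) hTX)
  have herase : #(T.erase x) ≤ #(T ∩ I) :=
    card_le_card (subset_inter (erase_subset x T) (subset_insert_iff.1 hTI))
  have hcard := card_erase_add_one hxT
  exact ⟨(X, T), ⟨hTX, by dsimp only; omega⟩, hX, hxT⟩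

lemma IsTight.sup [DecidableEq V] {p q : Finset V × Finset Ω}
    (hI : CountIndep supp col h I) (hp : IsTight supp col h I p)
    (hq : IsTight supp col h I q) (hpq : (p.1 ∩ q.1).Nonempty) :
    IsTight supp col h I (p ⊔ q) where
  supp_subset x hx := (mem_union.1 hx).elim
    (fun hxp ↦ (hp.supp_subset x hxp).trans subset_union_left)
    (fun hxq ↦ (hq.supp_subset x hxq).trans subset_union_right)
  le := by
    have hinter := hI (p.1 ∩ q.1) hpq (p.2 ∩ q.2 ∩ I) inter_subset_right fun x hx ↦ by
      simp only [mem_inter] at hx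
      exact subset_inter (hp.supp_subset x hx.1.1) (hq.supp_subset x hx.1.2)
    have hcol : #((p.2 ∩ q.2 ∩ I).biUnion col) ≤ #(p.2.biUnion col ∩ q.2.biUnion col) :=
      card_le_card <| (biUnion_subset_biUnion_of_subset_left col inter_subset_left).trans <|
        subset_inter (biUnion_subset_biUnion_of_subset_left col inter_subset_left)
          (biUnion_subset_biUnion_of_subset_left col inter_subset_right)
    have hmin := min_card_union_add_min_card_inter_le h (p.2.biUnion col) (q.2.biUnion col)
    rw [← union_biUnion] at hmin
    have hvert := congrArg (h * ·) (card_union_add_card_inter p.1 q.1)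
    simp only [mul_add] at hvert
    have helem := card_union_add_card_inter (p.2 ∩ I) (q.2 ∩ I)
    rw [← union_inter_distrib_right, ← inter_inter_distrib_right] at helem
    have hp_le := hp.le
    have hq_le := hq.le
    simp only [Prod.fst_sup, Prod.snd_sup, sup_eq_union]
    omega

lemma IsTight.le_of_maximal [DecidableEq V] {p q : Finset V × Finset Ω}
    (hI : CountIndep supp col h I) (hq : IsTight supp col h I q)
    (hp : Maximal (IsTight supp col h I) p) (hpq : (p.1 ∩ q.1).Nonempty) : q ≤ p :=
  le_sup_right.trans (hp.2 (hp.1.sup hI hq hpq) le_sup_left)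

section MaximalTightPairs

variable [Finite V] [Finite Ω]

/-- The maximal tight pairs; they certify that an independent set is maximal. -/
noncomputable def maximalTightPairs (supp : Ω → Finset V) (col : Ω → Finset κ) (h : ℕ)
    (I : Finset Ω) : Finset (Finset V × Finset Ω) :=
  {p | Maximal (IsTight supp col h I) p ∧ p.1.Nonempty}.toFinite.toFinset

lemma mem_maximalTightPairs {p : Finset V × Finset Ω} :
    p ∈ maximalTightPairs supp col h I ↔ Maximal (IsTight supp col h I) p ∧ p.1.Nonempty := by
  simp [maximalTightPairs]

lemma IsTight.exists_le_mem_maximalTightPairs {q : Finset V × Finset Ω}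
    (hq : IsTight supp col h I q) (hne : q.1.Nonempty) :
    ∃ p ∈ maximalTightPairs supp col h I, q ≤ p := by
  obtain ⟨p, hqp, hp⟩ := Finite.exists_le_maximal hq
  exact ⟨p, mem_maximalTightPairs.2 ⟨hp, hne.mono hqp.1⟩, hqp⟩

lemma CountIndep.isSupportedPartition_maximalTightPairs (hI : CountIndep supp col h I) :
    IsSupportedPartition supp (maximalTightPairs supp col h I) where
  nonempty p hp := (mem_maximalTightPairs.1 hp).2
  supp_subset p hp := (mem_maximalTightPairs.1 hp).1.1.supp_subset
  pairwiseDisjoint p hp q hq hpq := by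
    classical
    have hp := (mem_maximalTightPairs.1 hp).1
    have hq := (mem_maximalTightPairs.1 hq).1
    by_contra hne
    rw [Function.onFun, not_disjoint_iff_nonempty_inter] at hne
    exact hpq ((hp.1.le_of_maximal hI hq (inter_comm p.1 q.1 ▸ hne)).antisymm
      (hq.1.le_of_maximal hI hp hne))
  exists_mem v := by
    obtain ⟨p, hp, hvp⟩ := (isTight_singleton supp col h I v).exists_le_mem_maximalTightPairs
      (singleton_nonempty v)
    exact ⟨p, hp, singleton_subset_iff.1 hvp.1⟩

end MaximalTightPairs

theorem CountIndep.exists_isSupportedPartition [Fintype V] [Finite Ω]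
    (hI : CountIndep supp col h I) (hs : ∀ x, (supp x).Nonempty) {Z : Finset Ω}
    (hmax : ∀ x ∈ Z, x ∉ I → ¬ CountIndep supp col h (insert x I)) :
    ∃ P, IsSupportedPartition supp P ∧
      h * Fintype.card V + ∑ p ∈ P, min h #(p.2.biUnion col) + #(Z \ P.biUnion Prod.snd) ≤
        #I + h * #P := by
  set P := maximalTightPairs supp col h I
  have hP : IsSupportedPartition supp P := hI.isSupportedPartition_maximalTightPairs
  refine ⟨P, hP, ?_⟩
  have houtside : #(Z \ P.biUnion Prod.snd) ≤ #(I \ P.biUnion Prod.snd) := by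
    refine card_le_card fun x hx ↦ ?_
    obtain ⟨hxZ, hxP⟩ := mem_sdiff.1 hx
    refine mem_sdiff.2 ⟨by_contra fun hxI ↦ hxP ?_, hxP⟩
    obtain ⟨q, hq, hne, hxq⟩ := hI.exists_isTight_of_insert (hmax x hxZ hxI)
    obtain ⟨p, hp, hqp⟩ := hq.exists_le_mem_maximalTightPairs hne
    exact mem_biUnion.2 ⟨p, hp, hqp.2 hxq⟩
  have hinside : ∑ p ∈ P, #(p.2 ∩ I) = #(P.biUnion Prod.snd ∩ I) := by
    rw [biUnion_inter, card_biUnion]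
    exact fun p hp q hq hpq ↦ (hP.pairwiseDisjoint_snd hs hp hq hpq).mono inter_subset_left
      inter_subset_left
  have htight : h * Fintype.card V + ∑ p ∈ P, min h #(p.2.biUnion col) ≤
      ∑ p ∈ P, #(p.2 ∩ I) + h * #P :=
    calc h * Fintype.card V + ∑ p ∈ P, min h #(p.2.biUnion col)
        = ∑ p ∈ P, (h * #p.1 + min h #(p.2.biUnion col)) := by
          rw [sum_add_distrib, ← mul_sum, hP.sum_card]
      _ ≤ ∑ p ∈ P, (#(p.2 ∩ I) + h) :=
          sum_le_sum fun p hp ↦ (mem_maximalTightPairs.1 hp).1.1.le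
      _ = ∑ p ∈ P, #(p.2 ∩ I) + h * #P := by
          rw [sum_add_distrib, sum_const, smul_eq_mul, mul_comm h]
  have hsplit := card_inter_add_card_sdiff I (P.biUnion Prod.snd)
  rw [inter_comm] at hsplit
  omega

lemma CountIndep.augment [Finite V] [Finite Ω] (hs : ∀ x, (supp x).Nonempty)
    (hI : CountIndep supp col h I) (hJ : CountIndep supp col h J) (hIJ : #I < #J) :
    ∃ x ∈ J, x ∉ I ∧ CountIndep supp col h (insert x I) := by
  have := Fintype.ofFinite V
  by_contra! hno
  obtain ⟨P, hP, hle⟩ := hI.exists_isSupportedPartition hs hno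
  have := hJ.card_add_mul_card_le hP
  omega

/-- The matroid with independent sets given by `CountIndep`. -/
def countMatroid [Finite V] [Finite Ω] (col : Ω → Finset κ) (h : ℕ)
    (hs : ∀ x, (supp x).Nonempty) : Matroid Ω :=
  (IndepMatroid.ofFinset Set.univ (CountIndep supp col h) countIndep_empty
    (fun _ _ hJ hIJ ↦ hJ.subset hIJ) (fun _ _ hI hJ hIJ ↦ hI.augment hs hJ hIJ)
    fun _ _ ↦ Set.subset_univ _).matroid

lemma countMatroid_indep [Finite V] [Finite Ω] (hs : ∀ x, (supp x).Nonempty) :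
    (countMatroid col h hs).Indep I ↔ CountIndep supp col h I := by
  simp [countMatroid]

theorem exists_isSupportedPartition_le_eRk [Fintype V] [Finite Ω]
    (hs : ∀ x, (supp x).Nonempty) (Z : Finset Ω) :
    ∃ P, IsSupportedPartition supp P ∧
      (h * Fintype.card V + ∑ p ∈ P, min h #(p.2.biUnion col) + #(Z \ P.biUnion Prod.snd) : ℕ) ≤
        (countMatroid col h hs).eRk Z + (h * #P : ℕ) := by
  obtain ⟨B, hB⟩ := (countMatroid col h hs).exists_isBasis (Z : Set Ω) (Set.subset_univ _)
  lift B to Finset Ω using B.toFinite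
  have hmax (x : Ω) (hxZ : x ∈ Z) (hxB : x ∉ B) : ¬ CountIndep supp col h (insert x B) := by
    rw [← countMatroid_indep hs, coe_insert]
    exact (hB.insert_dep ⟨hxZ, hxB⟩).not_indep
  obtain ⟨P, hP, hle⟩ :=
    ((countMatroid_indep hs).1 hB.indep).exists_isSupportedPartition hs hmax
  refine ⟨P, hP, ?_⟩
  rw [hB.eRk_eq_encard, Set.encard_coe_eq_coe_finsetCard]
  exact_mod_cast hle

end CountMatroid

lemma mul_le_sum_min_add {κ : Type*} [Fintype κ] (s : κ → ℕ) {h q m : ℕ}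
    (hq : h * (q + 1) ≤ ∑ i, min (s i) (q + 1) + m) : h * q ≤ ∑ i, min (s i) q + m := by
  have hstep : ∑ i, min (s i) (q + 1) = ∑ i, min (s i) q + #{i | q < s i} := by
    rw [card_filter, ← sum_add_distrib]
    exact sum_congr rfl fun i _ ↦ by split_ifs <;> omega
  have hlarge : #{i | q < s i} * q ≤ ∑ i, min (s i) q := by
    rw [← smul_eq_mul, ← sum_const, sum_filter]
    exact sum_le_sum fun i _ ↦ by split_ifs <;> omega
  obtain hle | hlt := le_or_gt #{i | q < s i} h
  · rw [mul_add, hstep] at hq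
    omega
  · exact ((Nat.mul_le_mul_right q hlt.le).trans hlarge).trans (Nat.le_add_right _ m)

section RootedElements

variable {V E κ : Type*}

/-- The vertices of an element of the ground set `E ⊕ V × κ`, which consists of the edges `e`, with
ends `a e` and `b e`, and the coloured roots `(v, i)`: vertex `v` as a root of the forest `i`. -/
def rootedSupp [DecidableEq V] (a b : E → V) : E ⊕ V × κ → Finset V :=
  Sum.elim (fun e ↦ {a e, b e}) fun p ↦ {p.1}

/-- The colours of an edge (none) or of a coloured root. -/
def rootedCol : E ⊕ V × κ → Finset κ := Sum.elim (fun _ ↦ ∅) fun p ↦ {p.2}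

/-- The class of an element when edges (class `none`) and roots of every colour are counted
separately. -/
def rootedClass : E ⊕ V × κ → Option κ := Sum.elim (fun _ ↦ none) fun p ↦ some p.2

@[simp] lemma rootedClass_inl (e : E) : rootedClass (Sum.inl e : E ⊕ V × κ) = none := rfl

@[simp] lemma rootedClass_inr (p : V × κ) : rootedClass (Sum.inr p : E ⊕ V × κ) = some p.2 := rfl

lemma rootedSupp_nonempty [DecidableEq V] (a b : E → V) (x : E ⊕ V × κ) :
    (rootedSupp a b x).Nonempty := by
  rcases x with e | p <;> simp [rootedSupp]

variable [DecidableEq κ]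

lemma mem_biUnion_rootedCol {T : Finset (E ⊕ V × κ)} {i : κ} :
    i ∈ T.biUnion rootedCol ↔ ∃ v, Sum.inr (v, i) ∈ T := by
  simp [rootedCol]

lemma countIndep_map_inr [Fintype V] [DecidableEq V] {a b : E → V} {h : ℕ} {D : Finset κ}
    (hD : #D ≤ h) :
    CountIndep (rootedSupp a b) rootedCol h ((univ ×ˢ D).map .inr) := by
  intro X hX T hT hTX
  set c := #(T.biUnion rootedCol) with hc
  have hT' (x : E ⊕ V × κ) (hx : x ∈ T) : ∃ v, ∃ i ∈ D, Sum.inr (v, i) = x := by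
    simpa [eq_comm] using hT hx
  have hcD : c ≤ #D := card_le_card fun i hi ↦ by
    obtain ⟨v, hv⟩ := mem_biUnion_rootedCol.1 hi
    simpa using hT hv
  have hcard : #T ≤ #X * c := by
    rw [hc, ← card_product, ← card_map (s := X ×ˢ T.biUnion rootedCol) (.inr (α := E))]
    refine card_le_card fun x hx ↦ ?_
    obtain ⟨v, i, -, rfl⟩ := hT' x hx
    refine mem_map_of_mem _ (mem_product.2 ⟨?_, mem_biUnion_rootedCol.2 ⟨v, hx⟩⟩)
    simpa [rootedSupp] using hTX _ hx
  obtain ⟨m, hm⟩ := Nat.exists_eq_add_of_le' hX.card_pos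
  obtain ⟨d, rfl⟩ := Nat.exists_eq_add_of_le (hcD.trans hD)
  rw [hm] at hcard ⊢
  rw [min_eq_right (Nat.le_add_right c d)]
  nlinarith

variable [DecidableEq V] [DecidableEq E]

lemma card_filter_rootedClass_eq_none [Fintype E] (U : Finset (E ⊕ V × κ)) :
    #{x ∈ U | rootedClass x = none} = #{e | Sum.inl e ∈ U} := by
  rw [← card_map (Function.Embedding.inl (β := V × κ)) (s := {e | Sum.inl e ∈ U})]
  congr 1
  ext (e | p) <;> simp

variable [Fintype V]

lemma card_filter_rootedClass_eq_some (U : Finset (E ⊕ V × κ)) (i : κ) :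
    #{x ∈ U | rootedClass x = some i} = #{v | Sum.inr (v, i) ∈ U} := by
  rw [← card_map ((Function.Embedding.sectL V i).trans (Function.Embedding.inr (α := E)))
    (s := {v | Sum.inr (v, i) ∈ U})]
  congr 1
  ext (e | ⟨v, j⟩)
  · simp
  · simp; grind

variable {a b : E → V}

lemma IsSupportedPartition.card_filter_notMem_col_le
    {P Q : Finset (Finset V × Finset (E ⊕ V × κ))} (hP : IsSupportedPartition (rootedSupp a b) P)
    (hQP : Q ⊆ P) (i : κ) :
    #{p ∈ Q | i ∉ p.2.biUnion rootedCol} ≤ #{v | Sum.inr (v, i) ∉ P.biUnion Prod.snd} := by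
  refine card_le_card_of_forall_subsingleton (fun p v ↦ v ∈ p.1) (fun p hp ↦ ?_)
    fun v _ p hp q hq ↦ ?_
  · obtain ⟨hpQ, hip⟩ := mem_filter.1 hp
    obtain ⟨v, hv⟩ := hP.nonempty p (hQP hpQ)
    refine ⟨v, mem_filter.2 ⟨mem_univ v, fun hmem ↦ ?_⟩, hv⟩
    obtain ⟨q, hq, hvq⟩ := mem_biUnion.1 hmem
    obtain rfl := hP.eq_of_mem (hQP hpQ) hq hv (hP.supp_subset q hq _ hvq (by simp [rootedSupp]))
    exact hip (mem_biUnion_rootedCol.2 ⟨v, hvq⟩)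
  · exact hP.eq_of_mem (hQP (mem_filter.1 hp.1).1) (hQP (mem_filter.1 hq.1).1) hp.2 hq.2

lemma IsSupportedPartition.sum_min_card_le [Fintype κ]
    {P Q : Finset (Finset V × Finset (E ⊕ V × κ))} (hP : IsSupportedPartition (rootedSupp a b) P)
    (hQP : Q ⊆ P) (s : κ → ℕ) :
    ∑ i, min (s i) #Q ≤ ∑ p ∈ Q, #(p.2.biUnion rootedCol) +
      ∑ i, min (s i) #{v | Sum.inr (v, i) ∉ P.biUnion Prod.snd} := by
  have hcol : ∑ p ∈ Q, #(p.2.biUnion rootedCol) = ∑ i, #{p ∈ Q | i ∈ p.2.biUnion rootedCol} := by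
    simp only [card_filter]
    rw [sum_comm]
    simp only [sum_boole, filter_mem_eq_inter, univ_inter, Nat.cast_id]
  rw [hcol, ← sum_add_distrib]
  refine sum_le_sum fun i _ ↦ ?_
  have hfree := hP.card_filter_notMem_col_le hQP i
  have hsplit := card_filter_add_card_filter_not (s := Q) fun p ↦ i ∈ p.2.biUnion rootedCol
  omega

variable [Fintype E] [Fintype κ] {h : ℕ} {s : κ → ℕ}

/-- Every partition of the vertex set into `m` parts satisfies
`h * m ≤ ∑ i, min (s i) m + #crossing edges`. A partition is given as the fibres of a map `φ`,
for instance the map sending a vertex to its part. -/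
def PartitionCondition (a b : E → V) (h : ℕ) (s : κ → ℕ) : Prop :=
  ∀ φ : V → Finset V,
    h * #(univ.image φ) ≤ ∑ i, min (s i) #(univ.image φ) + #{e | φ (a e) ≠ φ (b e)}

lemma PartitionCondition.mul_card_le_of_subset (hs : PartitionCondition a b h s)
    {P Q : Finset (Finset V × Finset (E ⊕ V × κ))} (hP : IsSupportedPartition (rootedSupp a b) P)
    (hQP : Q ⊆ P) :
    h * #Q ≤ ∑ i, min (s i) #Q + #{e | Sum.inl e ∉ P.biUnion Prod.snd} := by
  choose F hFP hvF using hP.exists_mem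
  have hF {p} (hp : p ∈ P) {v} (hv : v ∈ p.1) : F v = p := hP.eq_of_mem (hFP v) hp (hvF v) hv
  -- All parts outside `Q` are merged into one, which concavity then allows to discard.
  let φ : V → Finset V := fun v ↦ if F v ∈ Q then (F v).1 else ∅
  have hcross : #{e | φ (a e) ≠ φ (b e)} ≤ #{e | Sum.inl e ∉ P.biUnion Prod.snd} := by
    refine card_le_card (monotone_filter_right _ fun e _ he hmem ↦ he ?_)
    obtain ⟨p, hp, hep⟩ := mem_biUnion.1 hmem
    have hends := hP.supp_subset p hp _ hep
    simp only [rootedSupp, Sum.elim_inl, insert_subset_iff, singleton_subset_iff] at hends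
    simp only [φ, hF hp hends.1, hF hp hends.2]
  have hlower : Q.image Prod.fst ⊆ univ.image φ := by
    refine image_subset_iff.2 fun p hp ↦ ?_
    obtain ⟨v, hv⟩ := hP.nonempty p (hQP hp)
    exact mem_image.2 ⟨v, mem_univ _, by simp only [φ, hF (hQP hp) hv, if_pos hp]⟩
  have hupper : univ.image φ ⊆ insert ∅ (Q.image Prod.fst) := by
    refine image_subset_iff.2 fun v _ ↦ ?_
    by_cases hv : F v ∈ Q
    · simpa only [φ, if_pos hv] using mem_insert_of_mem (mem_image_of_mem Prod.fst hv)
    · simp [φ, hv]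
  have hinj : Set.InjOn Prod.fst (Q : Set (Finset V × Finset (E ⊕ V × κ))) := by
    intro p hp q hq hpq
    obtain ⟨v, hv⟩ := hP.nonempty p (hQP hp)
    exact hP.eq_of_mem (hQP hp) (hQP hq) hv (hpq ▸ hv)
  have hcard := card_image_of_injOn hinj
  have hlower := card_le_card hlower
  have hupper := (card_le_card hupper).trans (card_insert_le _ _)
  have hφ := (hs φ).trans (Nat.add_le_add_left hcross _)
  obtain heq | heq : #(univ.image φ) = #Q ∨ #(univ.image φ) = #Q + 1 := by omega
  · rwa [heq] at hφ
  · exact mul_le_sum_min_add s (heq ▸ hφ)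

lemma PartitionCondition.mul_card_le (hs : PartitionCondition a b h s)
    {P : Finset (Finset V × Finset (E ⊕ V × κ))} (hP : IsSupportedPartition (rootedSupp a b) P) :
    h * #P ≤ ∑ p ∈ P, min h #(p.2.biUnion rootedCol) +
      #{e | Sum.inl e ∉ P.biUnion Prod.snd} +
      ∑ i, min (s i) #{v | Sum.inr (v, i) ∉ P.biUnion Prod.snd} := by
  let Q : Finset (Finset V × Finset (E ⊕ V × κ)) := {p ∈ P | #(p.2.biUnion rootedCol) < h}
  have hQP : Q ⊆ P := filter_subset _ _
  have hsplit : ∑ p ∈ P, min h #(p.2.biUnion rootedCol) + h * #Q =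
      ∑ p ∈ Q, #(p.2.biUnion rootedCol) + h * #P := by
    simp only [Q, card_filter, sum_filter, card_eq_sum_ones P, mul_sum, ← sum_add_distrib]
    exact sum_congr rfl fun p _ ↦ by split_ifs <;> omega
  have hmerge := hs.mul_card_le_of_subset hP hQP
  have hmin := hP.sum_min_card_le hQP s
  omega

/-- The count matroid on the edges and coloured roots. -/
abbrev rootedMatroid (κ : Type*) [Fintype κ] [DecidableEq κ] (a b : E → V) (h : ℕ) :
    Matroid (E ⊕ V × κ) :=
  countMatroid rootedCol h (rootedSupp_nonempty a b)

lemma sum_le_eRk_rootedClass_map_some (hs : ∀ i, s i ≤ Fintype.card V)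
    (hsum : ∑ i, s i ≤ h * Fintype.card V) (D : Finset κ) :
    (∑ i ∈ D, s i : ℕ) ≤ (rootedMatroid κ a b h).eRk {x | rootedClass x ∈ D.map .some} := by
  obtain ⟨D', hD', hcard⟩ := exists_subset_card_eq (min_le_right h #D)
  set I : Finset (E ⊕ V × κ) := (univ ×ˢ D').map .inr
  have hI : (rootedMatroid κ a b h).Indep I :=
    (countMatroid_indep _).2 (countIndep_map_inr (hcard.trans_le (min_le_left _ _)))
  have hsub : (I : Set (E ⊕ V × κ)) ⊆ {x | rootedClass x ∈ D.map .some} := fun x hx ↦ by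
    obtain ⟨v, i, hi, rfl⟩ : ∃ v, ∃ i ∈ D', Sum.inr (v, i) = x := by simpa [I, eq_comm] using hx
    simpa using hD' hi
  have hle : ∑ i ∈ D, s i ≤ #I := by
    rw [card_map, card_product, card_univ, hcard, ← Nat.mul_min_mul_left]
    refine le_min ?_ ?_
    · exact (sum_le_univ_sum_of_nonneg fun _ ↦ Nat.zero_le _).trans (hsum.trans_eq (mul_comm _ _))
    · exact (sum_le_card_nsmul _ _ _ fun i _ ↦ hs i).trans_eq (by rw [smul_eq_mul, mul_comm])
  calc ((∑ i ∈ D, s i : ℕ) : ℕ∞) ≤ #I := by exact_mod_cast hle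
    _ = (I : Set (E ⊕ V × κ)).encard := (Set.encard_coe_eq_coe_finsetCard I).symm
    _ ≤ _ := hI.encard_le_eRk_of_subset hsub

lemma PartitionCondition.le_eRk_rootedClass_insertNone (hs : PartitionCondition a b h s)
    (hsum : ∑ i, s i ≤ h * Fintype.card V) (D : Finset κ) :
    (h * Fintype.card V - ∑ i, s i + ∑ i ∈ D, s i : ℕ) ≤
      (rootedMatroid κ a b h).eRk {x | rootedClass x ∈ insertNone D} := by
  set Z : Finset (E ⊕ V × κ) := {x | rootedClass x ∈ insertNone D}
  obtain ⟨P, hP, hcert⟩ := exists_isSupportedPartition_le_eRk (h := h) (col := rootedCol)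
    (rootedSupp_nonempty a b) Z
  have hpart := hs.mul_card_le hP
  have hmin : ∑ i, min (s i) #{v | Sum.inr (v, i) ∉ P.biUnion Prod.snd} + ∑ i ∈ D, s i ≤
      ∑ i, s i + ∑ i ∈ D, #{v | Sum.inr (v, i) ∉ P.biUnion Prod.snd} := by
    simp only [← sum_add_sum_compl D]
    have h₁ := sum_le_sum fun i (_ : i ∈ D) ↦
      min_le_right (s i) #{v | Sum.inr (v, i) ∉ P.biUnion Prod.snd}
    have h₂ := sum_le_sum fun i (_ : i ∈ Dᶜ) ↦
      min_le_left (s i) #{v | Sum.inr (v, i) ∉ P.biUnion Prod.snd}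
    omega
  have hout : #(Z \ P.biUnion Prod.snd) = #{e | Sum.inl e ∉ P.biUnion Prod.snd} +
      ∑ i ∈ D, #{v | Sum.inr (v, i) ∉ P.biUnion Prod.snd} := by
    have hmaps : ∀ x ∈ Z \ P.biUnion Prod.snd, rootedClass x ∈ insertNone D := fun x hx ↦ by
      simp_all [Z]
    rw [card_eq_sum_card_fiberwise hmaps, sum_insertNone, card_filter_rootedClass_eq_none]
    simp only [card_filter_rootedClass_eq_some]
    have hinl (e : E) : Sum.inl e ∈ Z := by simp [Z]
    have hinr (v : V) {i : κ} (hi : i ∈ D) : Sum.inr (v, i) ∈ Z := by simpa [Z] using hi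
    congr 1
    · simp only [mem_sdiff, hinl, true_and]
    · exact sum_congr rfl fun i hi ↦ by simp only [mem_sdiff, hinr _ hi, true_and]
  have hZ : (Z : Set (E ⊕ V × κ)) = {x | rootedClass x ∈ insertNone D} := by simp [Z]
  rw [← hZ, ← ENat.add_le_add_iff_right (ENat.natCast_ne_top (h * #P))]
  refine le_trans ?_ hcert
  norm_cast
  omega

theorem PartitionCondition.exists_countIndep_card_eq (hP : PartitionCondition a b h s)
    (hs : ∀ i, s i ≤ Fintype.card V) (hsum : ∑ i, s i ≤ h * Fintype.card V) :
    ∃ I : Finset (E ⊕ V × κ), CountIndep (rootedSupp a b) rootedCol h I ∧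
      #I = h * Fintype.card V ∧ ∀ i, #{v | Sum.inr (v, i) ∈ I} = s i := by
  let cap : Option κ → ℕ := fun c ↦ c.elim (h * Fintype.card V - ∑ i, s i) s
  obtain ⟨I, hI, hcap⟩ := exists_indep_card_fiber_eq (M := rootedMatroid κ a b h)
    (c := rootedClass) (cap := cap) fun C ↦ by
      by_cases hC : none ∈ C
      · obtain ⟨D, rfl⟩ : ∃ D, insertNone D = C := ⟨eraseNone C, by simp [hC]⟩
        simpa [cap, sum_insertNone] using hP.le_eRk_rootedClass_insertNone hsum D
      · obtain ⟨D, rfl⟩ : ∃ D : Finset κ, D.map .some = C := ⟨eraseNone C, by simp [hC]⟩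
        simpa [cap] using sum_le_eRk_rootedClass_map_some hs hsum D
  refine ⟨I, (countMatroid_indep _).1 hI, ?_, fun i ↦ ?_⟩
  · rw [card_eq_sum_card_fiberwise fun x _ ↦ mem_univ (rootedClass x),
      sum_congr rfl fun c _ ↦ hcap c, Fintype.sum_option]
    exact Nat.sub_add_cancel hsum
  · rw [← card_filter_rootedClass_eq_some, hcap]
    rfl

end RootedElements

section Packing

variable {V E κ : Type*} [DecidableEq V]

/-- The arcs of `A` entering the vertex set `X`. -/
def entering (tail head : E → V) (A : Finset E) (X : Finset V) : Finset E :=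
  {e ∈ A | head e ∈ X ∧ tail e ∉ X}

lemma entering_univ [Fintype V] (tail head : E → V) (A : Finset E) :
    entering tail head A univ = ∅ := by
  simp [entering]

lemma card_entering_inter_add_card_entering_union_le (tail head : E → V) (A : Finset E)
    (X Y : Finset V) :
    #(entering tail head A (X ∩ Y)) + #(entering tail head A (X ∪ Y)) ≤
      #(entering tail head A X) + #(entering tail head A Y) := by
  simp only [entering, card_filter, ← sum_add_distrib]
  refine sum_le_sum fun e _ ↦ ?_
  simp only [mem_inter, mem_union]
  grind

/-- The colours present at a vertex: the indices of the sets `W i` containing it. -/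
def colours [Fintype κ] (W : κ → Finset V) (v : V) : Finset κ := {i | v ∈ W i}

@[simp] lemma mem_colours [Fintype κ] {W : κ → Finset V} {v : V} {i : κ} :
    i ∈ colours W v ↔ v ∈ W i := by
  simp [colours]

variable [DecidableEq κ]

lemma colours_update_insert [Fintype κ] (W : κ → Finset V) (w : V) (i : κ) :
    colours (Function.update W i (insert w (W i))) =
      Function.update (colours W) w (insert i (colours W w)) := by
  ext v j
  obtain rfl | hj := eq_or_ne j i <;> obtain rfl | hv := eq_or_ne v w <;> simp [*]

/-- Edmonds' condition for completing a packing in which the colours present at a vertex `v` are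
`C v`, using the arcs of `A`: any nonempty vertex set can still see `h` colours. -/
def CutCondition (tail head : E → V) (A : Finset E) (C : V → Finset κ) (h : ℕ) : Prop :=
  ∀ X : Finset V, X.Nonempty → h ≤ #(entering tail head A X) + #(X.biUnion C)

/-- A vertex set for which the cut condition holds with equality. -/
def IsCutTight (tail head : E → V) (A : Finset E) (C : V → Finset κ) (h : ℕ) (X : Finset V) :
    Prop :=
  #(entering tail head A X) + #(X.biUnion C) = h

variable {tail head : E → V} {A : Finset E} {C : V → Finset κ} {h : ℕ} {X Y : Finset V}

lemma IsCutTight.inter (hX : IsCutTight tail head A C h X) (hY : IsCutTight tail head A C h Y)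
    (hC : CutCondition tail head A C h) (hXY : (X ∩ Y).Nonempty) :
    IsCutTight tail head A C h (X ∩ Y) ∧ (X ∩ Y).biUnion C = X.biUnion C ∩ Y.biUnion C := by
  unfold IsCutTight at *
  have hsubmod := card_entering_inter_add_card_entering_union_le tail head A X Y
  have hcard := card_union_add_card_inter (X.biUnion C) (Y.biUnion C)
  have hinter := hC _ hXY
  have hunion := hC (X ∪ Y) (hXY.mono (inter_subset_left.trans subset_union_left))
  rw [union_biUnion] at hunion
  have hsub : (X ∩ Y).biUnion C ⊆ X.biUnion C ∩ Y.biUnion C := subset_inter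
    (biUnion_subset_biUnion_of_subset_left _ inter_subset_left)
    (biUnion_subset_biUnion_of_subset_left _ inter_subset_right)
  have hle := card_le_card hsub
  exact ⟨by omega, eq_of_subset_of_card_le hsub (by omega)⟩

lemma CutCondition.exists_arc (hC : CutCondition tail head A C h) {v : V} (hvX : v ∈ X)
    (hv : #(entering tail head A X) + #(C v) < h) :
    ∃ e ∈ A, tail e ∈ X ∧ head e ∈ X ∧ #(C (head e)) < h ∧ ¬C (tail e) ⊆ C (head e) := by
  by_contra! hno
  have hent : entering tail head A {y ∈ X | C y ⊆ C v} ⊆ entering tail head A X := by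
    intro e he
    simp only [entering, mem_filter, not_and] at he ⊢
    obtain ⟨heA, ⟨hhX, hhv⟩, ht⟩ := he
    have hlt : #(C (head e)) < h :=
      (card_le_card hhv).trans_lt ((Nat.le_add_left _ _).trans_lt hv)
    exact ⟨heA, hhX, fun htX ↦ ht htX ((hno e heA htX hhX hlt).trans hhv)⟩
  have hcol : {y ∈ X | C y ⊆ C v}.biUnion C ⊆ C v :=
    biUnion_subset.2 fun y hy ↦ (mem_filter.1 hy).2
  have hcut := hC {y ∈ X | C y ⊆ C v} ⟨v, mem_filter.2 ⟨hvX, Subset.rfl⟩⟩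
  have := card_le_card hent
  have := card_le_card hcol
  omega

variable [DecidableEq E]

lemma CutCondition.erase_update (hC : CutCondition tail head A C h) {e : E} {i : κ}
    (hi : ∀ Z, IsCutTight tail head A C h Z → head e ∈ Z → tail e ∉ Z → i ∉ Z.biUnion C) :
    CutCondition tail head (A.erase e)
      (Function.update C (head e) (insert i (C (head e)))) h := by
  intro Z hZ
  have hcut := hC Z hZ
  have hmono : Z.biUnion C ⊆ Z.biUnion (Function.update C (head e) (insert i (C (head e)))) := by
    refine biUnion_mono fun z _ ↦ ?_
    rw [Function.update_apply]
    split_ifs with hz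
    · exact hz ▸ subset_insert _ _
    · rfl
  have hcol := card_le_card hmono
  rw [show entering tail head (A.erase e) Z = (entering tail head A Z).erase e from
    filter_erase ..]
  by_cases hent : e ∈ entering tail head A Z
  swap
  · rw [erase_eq_of_notMem hent]
    omega
  have hcard := card_erase_add_one hent
  obtain ⟨-, hhZ, htZ⟩ := mem_filter.1 hent
  by_cases htight : IsCutTight tail head A C h Z
  · have hgain := card_lt_card <| hmono.ssubset_of_mem_notMem
      (mem_biUnion.2 ⟨head e, hhZ, by simp⟩) (hi Z htight hhZ htZ)
    omega
  · unfold IsCutTight at htight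
    omega

lemma CutCondition.exists_erase_update [Finite V] (hC : CutCondition tail head A C h)
    (hdef : ∃ v, #(C v) < h) :
    ∃ e ∈ A, ∃ i ∈ C (tail e), i ∉ C (head e) ∧ #(C (head e)) < h ∧
      CutCondition tail head (A.erase e)
        (Function.update C (head e) (insert i (C (head e)))) h := by
  have := Fintype.ofFinite V
  obtain ⟨v₀, hv₀⟩ := hdef
  obtain ⟨X, hX⟩ := exists_minimal_of_wellFoundedLT (fun X ↦
    (IsCutTight tail head A C h X ∨ X = univ) ∧ ∃ v ∈ X, #(entering tail head A X) + #(C v) < h)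
    ⟨univ, Or.inr rfl, v₀, mem_univ _, by simpa [entering_univ] using hv₀⟩
  obtain ⟨hXtight, v, hvX, hv⟩ := hX.prop
  obtain ⟨e, heA, htX, hhX, hlt, hsub⟩ := hC.exists_arc hvX hv
  obtain ⟨i, hit, hih⟩ := not_subset.1 hsub
  refine ⟨e, heA, i, hit, hih, hlt, hC.erase_update fun Z hZ hhZ htZ hiZ ↦ ?_⟩
  -- Otherwise `X ∩ Z` contradicts the minimality of `X`.
  obtain ⟨htight, hiXZ⟩ : IsCutTight tail head A C h (X ∩ Z) ∧ i ∈ (X ∩ Z).biUnion C := by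
    obtain hX | rfl := hXtight
    · obtain ⟨htight, hcol⟩ := hX.inter hZ hC ⟨head e, mem_inter.2 ⟨hhX, hhZ⟩⟩
      exact ⟨htight, hcol ▸ mem_inter.2 ⟨mem_biUnion.2 ⟨_, htX, hit⟩, hiZ⟩⟩
    · rw [univ_inter]
      exact ⟨hZ, hiZ⟩
  have hhXZ : head e ∈ X ∩ Z := mem_inter.2 ⟨hhX, hhZ⟩
  have hgain := card_lt_card <|
    (subset_biUnion_of_mem C hhXZ).ssubset_of_mem_notMem hiXZ hih
  refine hX.not_prop_of_lt (inter_subset_left.ssubset_of_mem_notMem htX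
    fun ht ↦ htZ (mem_inter.1 ht).2) ⟨Or.inl htight, head e, hhXZ, ?_⟩
  unfold IsCutTight at htight
  omega

/-- `IsGrown tail head S W F`: starting from the vertex set `S`, one obtains `W` by successively
adding the arcs of `F`, each leading from a vertex already reached to a new one. -/
inductive IsGrown (tail head : E → V) (S : Finset V) : Finset V → Finset E → Prop
  | base : IsGrown tail head S S ∅
  | step {W : Finset V} {F : Finset E} (e : E) (hW : IsGrown tail head S W F)
      (ht : tail e ∈ W) (hh : head e ∉ W) (he : e ∉ F) :
      IsGrown tail head S (insert (head e) W) (insert e F)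

/-- Pairwise arc-disjoint branchings with root sets `S i`, vertex sets `W i` and arc sets `F i`. -/
structure IsGrownPacking (tail head : E → V) (S W : κ → Finset V) (F : κ → Finset E) : Prop where
  isGrown (i : κ) : IsGrown tail head (S i) (W i) (F i)
  disjoint : Pairwise fun i j ↦ Disjoint (F i) (F j)

lemma IsGrownPacking.update {S W : κ → Finset V} {F : κ → Finset E}
    (hW : IsGrownPacking tail head S W F) {e : E} {i : κ} (ht : tail e ∈ W i) (hh : head e ∉ W i)
    (he : ∀ j, e ∉ F j) :
    IsGrownPacking tail head S (Function.update W i (insert (head e) (W i)))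
      (Function.update F i (insert e (F i))) where
  isGrown j := by
    obtain rfl | hj := eq_or_ne j i
    · simpa using (hW.isGrown j).step e ht hh (he j)
    · simpa [hj] using hW.isGrown j
  disjoint j j' hjj' := by
    have := hW.disjoint hjj'
    obtain rfl | hj := eq_or_ne j i
    · simpa [hjj'.symm, disjoint_insert_left, he] using this
    obtain rfl | hj' := eq_or_ne j' i
    · simpa [hjj', disjoint_insert_right, he] using this
    · simpa [hj, hj'] using this

/-- Edmonds' branching packing theorem, for branchings that need not be spanning. -/
theorem IsGrownPacking.exists_regular [Finite V] [Fintype κ] {S W : κ → Finset V}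
    {F : κ → Finset E} (hW : IsGrownPacking tail head S W F) (hF : ∀ i, Disjoint (F i) A)
    (hle : ∀ v, #(colours W v) ≤ h)
    (hcut : CutCondition tail head A (colours W) h) :
    ∃ (W' : κ → Finset V) (F' : κ → Finset E), IsGrownPacking tail head S W' F' ∧
      (∀ i, F' i ⊆ F i ∪ A) ∧ ∀ v, #(colours W' v) = h := by
  induction A using Finset.strongInduction generalizing W F with
  | H A ih =>
    by_cases! hfull : ∀ v, h ≤ #(colours W v)
    · exact ⟨W, F, hW, fun i ↦ subset_union_left, fun v ↦ (hle v).antisymm (hfull v)⟩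
    obtain ⟨e, heA, i, hit, hih, hlt, hcut'⟩ := hcut.exists_erase_update hfull
    rw [← colours_update_insert] at hcut'
    have heF (j : κ) : e ∉ F j := disjoint_right.1 (hF j) heA
    have hle' (v : V) : #(colours (Function.update W i (insert (head e) (W i))) v) ≤ h := by
      rw [congrFun (colours_update_insert W (head e) i) v, Function.update_apply]
      split_ifs
      · exact (card_insert_le _ _).trans hlt
      · exact hle v
    have hF' (j : κ) : Disjoint (Function.update F i (insert e (F i)) j) (A.erase e) := by
      have hdisj := (hF j).mono_right (erase_subset e A)
      obtain rfl | hj := eq_or_ne j i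
      · simpa [disjoint_insert_left] using hdisj
      · simpa [hj] using hdisj
    obtain ⟨W', F', hW', hsub, hreg⟩ := ih (A.erase e) (erase_ssubset heA)
      (hW.update (mem_colours.1 hit) (mt mem_colours.2 hih) heF) hF' hle' hcut'
    refine ⟨W', F', hW', fun j ↦ (hsub j).trans ?_, hreg⟩
    rw [Function.update_apply]
    grind

end Packing

lemma CountIndep.exists_card_filter_eq {V Ω κ : Type*} [Fintype V] [DecidableEq V]
    [DecidableEq κ] {supp : Ω → Finset V} {col : Ω → Finset κ} {h : ℕ} {I : Finset Ω}
    (hI : CountIndep supp col h I) (hs : ∀ x, (supp x).Nonempty)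
    (hcard : #I = h * Fintype.card V) :
    ∃ f : Ω → V, (∀ x, f x ∈ supp x) ∧ ∀ v, #{x ∈ I | f x = v} = h := by
  classical
  have hall (A : Finset I) : #A ≤ #(A.biUnion fun x ↦ supp x ×ˢ (univ : Finset (Fin h))) := by
    obtain rfl | ⟨x₀, hx₀⟩ := A.eq_empty_or_nonempty
    · simp
    have hcount := hI (A.biUnion fun x ↦ supp x) ((hs x₀).mono (subset_biUnion_of_mem _ hx₀))
      (A.map (.subtype _)) (map_subtype_subset A) fun x hx ↦ by
        obtain ⟨y, hy, rfl⟩ := mem_map.1 hx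
        exact subset_biUnion_of_mem (fun x : I ↦ supp x) hy
    rw [card_map] at hcount
    have hprod : (A.biUnion fun x ↦ supp x ×ˢ (univ : Finset (Fin h))) =
        (A.biUnion fun x ↦ supp x) ×ˢ univ := by
      ext p
      simp
    rw [hprod, card_product, card_univ, Fintype.card_fin, mul_comm]
    omega
  obtain ⟨g, hginj, hgmem⟩ := (all_card_le_biUnion_card_iff_exists_injective _).1 hall
  have hgbij : Function.Bijective g :=
    (Fintype.bijective_iff_injective_and_card g).2 ⟨hginj, by simp [hcard, mul_comm]⟩
  choose f₀ hf₀ using hs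
  let f : Ω → V := fun x ↦ if hx : x ∈ I then (g ⟨x, hx⟩).1 else f₀ x
  refine ⟨f, fun x ↦ ?_, fun v ↦ ?_⟩
  · by_cases hx : x ∈ I
    · simpa [f, hx] using hgmem ⟨x, hx⟩
    · simpa [f, hx] using hf₀ x
  · have hmap : ({x ∈ I | f x = v} : Finset Ω) =
        ({x | (g x).1 = v} : Finset I).map (.subtype _) := by
      ext x
      by_cases hx : x ∈ I <;> simp [f, hx]
    have hfib : #{x | (g x).1 = v} = #({v} ×ˢ (univ : Finset (Fin h))) :=
      card_bijective g hgbij fun x ↦ by rw [mem_product]; simp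
    rw [hmap, card_map, hfib]
    simp

lemma exists_sym2_eq_of_mem {V E : Type*} [DecidableEq V] {a b head : E → V}
    (hmem : ∀ e, head e ∈ ({a e, b e} : Finset V)) :
    ∃ tail : E → V, ∀ e, s(tail e, head e) = s(a e, b e) := by
  choose tail htail using fun e ↦ Sym2.mem_iff_exists.1
    (show head e ∈ s(a e, b e) by simpa using hmem e)
  exact ⟨tail, fun e ↦ by rw [htail, Sym2.eq_swap]⟩

section OrientedPacking

variable {V E κ : Type*} [DecidableEq V] [DecidableEq E] [DecidableEq κ] [Fintype V]
  [Fintype κ] {a b tail head : E → V} {h : ℕ} {I : Finset (E ⊕ V × κ)}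

lemma card_colours_le (hI : ∀ v, #{x ∈ I | Sum.elim head Prod.fst x = v} = h) (v : V) :
    #(colours (fun i ↦ {v | Sum.inr (v, i) ∈ I}) v) ≤ h := by
  rw [← hI v, ← card_map ((Function.Embedding.sectR v κ).trans (.inr (α := E)))]
  refine card_le_card fun x hx ↦ ?_
  obtain ⟨i, hi, rfl⟩ := mem_map.1 hx
  simpa using hi

variable [Fintype E]

lemma CountIndep.cutCondition (hcount : CountIndep (rootedSupp a b) rootedCol h I)
    (hor : ∀ e, s(tail e, head e) = s(a e, b e))
    (hI : ∀ v, #{x ∈ I | Sum.elim head Prod.fst x = v} = h) :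
    CutCondition tail head {e | Sum.inl e ∈ I} (colours fun i ↦ {v | Sum.inr (v, i) ∈ I}) h := by
  intro X hX
  set T : Finset (E ⊕ V × κ) := {x ∈ I | rootedSupp a b x ⊆ X}
  have hheads : #{x ∈ I | Sum.elim head Prod.fst x ∈ X} = h * #X := by
    have hmaps : ∀ x ∈ ({x ∈ I | Sum.elim head Prod.fst x ∈ X} : Finset (E ⊕ V × κ)),
        Sum.elim head Prod.fst x ∈ X := fun x hx ↦ (mem_filter.1 hx).2
    rw [card_eq_sum_card_fiberwise hmaps, mul_comm, ← smul_eq_mul, ← sum_const]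
    refine sum_congr rfl fun v hv ↦ ?_
    rw [← hI v]
    congr 1
    grind
  have hcover : ({x ∈ I | Sum.elim head Prod.fst x ∈ X} : Finset (E ⊕ V × κ)) ⊆
      T ∪ (entering tail head {e | Sum.inl e ∈ I} X).map .inl := by
    intro x hx
    obtain ⟨hxI, hxX⟩ := mem_filter.1 hx
    obtain e | p := x
    · by_cases ht : tail e ∈ X
      · refine mem_union_left _ (mem_filter.2 ⟨hxI, ?_⟩)
        obtain ⟨h₁, h₂⟩ | ⟨h₁, h₂⟩ := Sym2.eq_iff.1 (hor e) <;>
          simp_all [rootedSupp, insert_subset_iff]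
      · exact mem_union_right _ (mem_map_of_mem _ (by simp_all [entering]))
    · exact mem_union_left _ (mem_filter.2 ⟨hxI, singleton_subset_iff.2 hxX⟩)
  have hcol : T.biUnion rootedCol ⊆ X.biUnion (colours fun i ↦ {v | Sum.inr (v, i) ∈ I}) := by
    intro i hi
    obtain ⟨v, hv⟩ := mem_biUnion_rootedCol.1 hi
    obtain ⟨hvI, hvX⟩ := mem_filter.1 hv
    exact mem_biUnion.2 ⟨v, singleton_subset_iff.1 hvX, by simpa using hvI⟩
  have hT := hcount X hX T (filter_subset _ _) fun x hx ↦ (mem_filter.1 hx).2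
  have := (card_le_card hcover).trans (card_union_le _ _)
  rw [card_map] at this
  have := card_le_card hcol
  omega

end OrientedPacking

theorem PartitionCondition.exists_isGrownPacking {V E κ : Type*} [DecidableEq V] [DecidableEq E]
    [Fintype V] [Fintype E] [Fintype κ] {a b : E → V} {h : ℕ} {s : κ → ℕ}
    (hP : PartitionCondition a b h s) (hs : ∀ i, s i ≤ Fintype.card V)
    (hsum : ∑ i, s i ≤ h * Fintype.card V) :
    ∃ (tail head : E → V) (S W : κ → Finset V) (F : κ → Finset E),
      (∀ e, s(tail e, head e) = s(a e, b e)) ∧ (∀ i, #(S i) = s i) ∧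
      IsGrownPacking tail head S W F ∧ ∀ v, #(colours W v) = h := by
  classical
  obtain ⟨I, hcount, hcard, hS⟩ := hP.exists_countIndep_card_eq hs hsum
  obtain ⟨f, hf, hI⟩ := hcount.exists_card_filter_eq (rootedSupp_nonempty a b) hcard
  obtain ⟨tail, hor⟩ := exists_sym2_eq_of_mem (head := f ∘ Sum.inl) fun e ↦ hf (Sum.inl e)
  have hf_eq : f = Sum.elim (f ∘ Sum.inl) Prod.fst := by
    ext (e | p)
    · rfl
    · exact mem_singleton.1 (hf (Sum.inr p))
  rw [hf_eq] at hI
  have hempty : IsGrownPacking tail (f ∘ Sum.inl) (fun i ↦ ({v | Sum.inr (v, i) ∈ I} : Finset V))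
      (fun i ↦ {v | Sum.inr (v, i) ∈ I}) fun _ ↦ ∅ :=
    ⟨fun _ ↦ .base, fun _ _ _ ↦ disjoint_empty_left _⟩
  obtain ⟨W, F, hW, -, hreg⟩ := hempty.exists_regular (fun _ ↦ disjoint_empty_left _)
    (card_colours_le hI) (hcount.cutCondition hor hI)
  exact ⟨tail, _, _, W, F, hor, hS, hW, hreg⟩

section RootCounts

variable {ι ρ : Type*} [Fintype ι] {l l' : ι → ℕ} {h n t : ℕ}

lemma exists_between_sum_eq {q d : ρ → ℕ} (hll' : l ≤ l') (hlt : ∑ i, l i ≤ t)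
    (htl' : t ≤ ∑ i, l' i) (hl : ∀ j, d j + ∑ i, l i ≤ t + ∑ i, min (l i) (q j))
    (hl' : ∀ j, d j ≤ ∑ i, min (l' i) (q j)) :
    ∃ s : ι → ℕ, l ≤ s ∧ s ≤ l' ∧ ∑ i, s i = t ∧ ∀ j, d j ≤ ∑ i, min (s i) (q j) := by
  classical
  obtain ⟨s, hs⟩ := exists_minimal_of_wellFoundedLT
    (fun s : ι → ℕ ↦ l ≤ s ∧ s ≤ l' ∧ t ≤ ∑ i, s i ∧ ∀ j, d j ≤ ∑ i, min (s i) (q j))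
    ⟨l', hll', le_rfl, htl', hl'⟩
  obtain ⟨hls, hsl', hts, hds⟩ := hs.prop
  refine ⟨s, hls, hsl', hts.antisymm' <| not_lt.1 fun hlt' ↦ ?_, hds⟩
  -- Lowering a largest `s i` exceeding `l i` would preserve all constraints.
  obtain ⟨i₀, hi₀⟩ : ∃ i, l i < s i := by
    by_contra! hle
    have := sum_le_sum fun i (_ : i ∈ univ) ↦ hle i
    omega
  obtain ⟨i, hi, hmax⟩ := exists_max_image {i | l i < s i} s ⟨i₀, by simpa using hi₀⟩
  simp only [mem_filter, mem_univ, true_and] at hi hmax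
  set s' := Function.update s i (s i - 1)
  have hval (j : ι) : s' j = if j = i then s i - 1 else s j := Function.update_apply ..
  have hsum : ∑ j, s' j + 1 = ∑ j, s j := by
    rw [show (1 : ℕ) = ∑ j, if j = i then 1 else 0 by simp, ← sum_add_distrib]
    exact sum_congr rfl fun j _ ↦ by rw [hval]; grind
  have hs's : s' < s := update_lt_self_iff.2 (by omega)
  refine hs.not_prop_of_lt hs's ⟨fun j ↦ ?_, hs's.le.trans hsl', by omega, fun j ↦ ?_⟩
  · have := hls j
    rw [hval]
    grind
  obtain hlarge | hsmall := lt_or_ge (q j) (s i)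
  · refine (hds j).trans (sum_le_sum fun j' _ ↦ ?_)
    rw [hval]
    grind
  · have htrunc : ∑ j', s' j' + ∑ j', min (l j') (q j) ≤
        ∑ j', min (s' j') (q j) + ∑ j', l j' := by
      rw [← sum_add_distrib, ← sum_add_distrib]
      refine sum_le_sum fun j' _ ↦ ?_
      have := hmax j'
      have := hls j'
      rw [hval]
      grind
    have := hl j
    omega

lemma mul_add_sum_le_mul_add_sum_min {q : ℕ} (hl : ∀ i, l i ≤ n) (hsum : ∑ i, l i ≤ h * n)
    (hq : q ≤ n) : h * q + ∑ i, l i ≤ h * n + ∑ i, min (l i) q := by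
  obtain rfl | hn := n.eq_zero_or_pos
  · obtain rfl := Nat.le_zero.1 hq
    simpa using hsum
  obtain ⟨r, rfl⟩ := Nat.exists_eq_add_of_le hq
  refine Nat.le_of_mul_le_mul_left ?_ hn
  -- `min (l i) q` lies above the chord through the values at `0` and at `q + r`.
  have hchord : (q + r) * ∑ i, l i ≤ r * ∑ i, l i + (q + r) * ∑ i, min (l i) q := by
    rw [mul_sum, mul_sum, mul_sum, ← sum_add_distrib]
    refine sum_le_sum fun i _ ↦ ?_
    have hi := hl i
    obtain hle | hgt := le_total (l i) q
    · rw [min_eq_left hle]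
      exact Nat.le_add_left _ _
    · rw [min_eq_right hgt]
      nlinarith
  have := Nat.mul_le_mul_left r hsum
  linarith

lemma exists_root_counts {q c : ρ → ℕ} {lower upper : ℕ} (hq : ∀ j, q j ≤ n) (hll' : l ≤ l')
    (hl' : ∀ i, l' i ≤ n) (hlower : ∑ i, l i ≤ lower) (hle : lower ≤ upper)
    (hupper : upper ≤ ∑ i, l' i) (hn : lower ≤ h * n)
    (hl_cut : ∀ j, h * q j + ∑ i, l i ≤ upper + ∑ i, min (l i) (q j) + c j)
    (hl'_cut : ∀ j, h * q j ≤ ∑ i, min (l' i) (q j) + c j) :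
    ∃ s : ι → ℕ, l ≤ s ∧ s ≤ l' ∧ ∑ i, s i = min upper (h * n) ∧
      ∀ j, h * q j ≤ ∑ i, min (s i) (q j) + c j := by
  have hl (j : ρ) := mul_add_sum_le_mul_add_sum_min (fun i ↦ (hll' i).trans (hl' i))
    (hlower.trans hn) (hq j)
  obtain ⟨s, hls, hsl', hsum, hs⟩ := exists_between_sum_eq (d := fun j ↦ h * q j - c j) hll'
    (le_min (hlower.trans hle) (hlower.trans hn)) (min_le_of_left_le hupper)
    (fun j ↦ by
      have := hl j
      have := hl_cut j
      have := sum_le_sum fun i (_ : i ∈ univ) ↦ min_le_left (l i) (q j)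
      omega)
    fun j ↦ Nat.sub_le_iff_le_add.2 (hl'_cut j)
  exact ⟨s, hls, hsl', hsum, fun j ↦ Nat.sub_le_iff_le_add.1 (hs j)⟩

end RootCounts

section Branching

variable {α β : Type*} {H H' G : Graph α β} {tail head : β → α} {S : Finset α} {u v : α}
  {w : List β}

lemma isDiWalk_mono (hV : V(H) ⊆ V(H')) (hE : E(H) ⊆ E(H')) (hw : H.IsDiWalk tail head u w v) :
    H'.IsDiWalk tail head u w v := by
  induction hw with
  | nil hu => exact .nil (hV hu)
  | cons he _ ih => exact .cons (hE he) ih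

lemma isDiWalk_append_singleton {e : β} (he : e ∈ E(H)) (hh : head e ∈ V(H))
    (hw : H.IsDiWalk tail head u w (tail e)) : H.IsDiWalk tail head u (w ++ [e]) (head e) := by
  generalize ht : tail e = v at hw
  induction hw with
  | nil => exact ht ▸ .cons he (.nil hh)
  | cons he' _ ih => exact .cons he' (ih ht)

lemma exists_entering_of_isDiWalk (hw : H.IsDiWalk tail head u w v) {X : Set α} (hu : u ∉ X)
    (hv : v ∈ X) : ∃ e ∈ E(H), tail e ∉ X ∧ head e ∈ X := by
  induction hw with
  | nil => exact absurd hv hu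
  | @cons e _ _ he _ ih =>
    by_cases hX : head e ∈ X
    · exact ⟨e, he, hu, hX⟩
    · exact ih hX hv

lemma eq_nil_and_eq_of_isDiWalk (hw : H.IsDiWalk tail head u w v)
    (hu : ∀ e ∈ E(H), tail e ≠ u) : w = [] ∧ v = u := by
  cases hw with
  | nil => exact ⟨rfl, rfl⟩
  | cons he => exact absurd rfl (hu _ he)

lemma isDiWalk_of_edgeSet_eq_insert (hor : H.IsOrientation tail head) {e : β}
    (hE : E(H') = insert e E(H)) (ht : tail e ∈ V(H)) (hh : head e ∉ V(H))
    (hw : H'.IsDiWalk tail head u w v) (hu : u ∈ V(H)) :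
    H.IsDiWalk tail head u w v ∨
      v = head e ∧ ∃ w', w = w' ++ [e] ∧ H.IsDiWalk tail head u w' (tail e) := by
  induction hw with
  | nil => exact Or.inl (.nil hu)
  | @cons f w v hf hw ih =>
    by_cases hfH : f ∈ E(H)
    · obtain hw' | ⟨rfl, w', rfl, hw'⟩ := ih (hor f hfH).right_mem
      · exact Or.inl (.cons hfH hw')
      · exact Or.inr ⟨rfl, f :: w', rfl, .cons hfH hw'⟩
    · obtain rfl : f = e := (hE ▸ hf).resolve_right hfH
      obtain ⟨rfl, rfl⟩ := eq_nil_and_eq_of_isDiWalk hw fun g hg hgt ↦ hh <| by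
        obtain rfl | hg := hE ▸ hg
        · exact hgt ▸ ht
        · exact hgt ▸ (hor g hg).left_mem
      exact Or.inr ⟨rfl, [], rfl, .nil ht⟩

lemma mem_vertexSet_of_isDiWalk (hw : H.IsDiWalk tail head u w v) : v ∈ V(H) := by
  induction hw with
  | nil hu => exact hu
  | cons _ _ ih => exact ih

lemma isBranching_of_edgeSet_eq_empty (hV : V(H) = S) (hE : E(H) = ∅) :
    H.IsBranching tail head S := by
  refine ⟨hV.symm.subset, fun u hu ↦ ⟨(u, []), ⟨hV.subset hu, .nil hu⟩, ?_⟩⟩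
  rintro ⟨v, w⟩ ⟨-, hw⟩
  obtain ⟨h_nil, h_eq⟩ := eq_nil_and_eq_of_isDiWalk hw (by simp [hE])
  exact Prod.ext h_eq.symm h_nil

lemma isBranching_of_edgeSet_eq_insert (hH : H.IsBranching tail head S)
    (hor : H.IsOrientation tail head) {e : β} (hV : V(H') = insert (head e) V(H))
    (hE : E(H') = insert e E(H)) (ht : tail e ∈ V(H)) (hh : head e ∉ V(H)) :
    H'.IsBranching tail head S := by
  have hVH : V(H) ⊆ V(H') := hV ▸ Set.subset_insert _ _
  have hEH : E(H) ⊆ E(H') := hE ▸ Set.subset_insert _ _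
  refine ⟨hH.1.trans hVH, fun u hu ↦ ?_⟩
  obtain rfl | hu := hV ▸ hu
  · obtain ⟨⟨x, w⟩, ⟨hxS, hxw⟩, huniq⟩ := hH.2 (tail e) ht
    refine ⟨(x, w ++ [e]), ⟨hxS, isDiWalk_append_singleton (hE ▸ Set.mem_insert _ _)
      (hV ▸ Set.mem_insert _ _) (isDiWalk_mono hVH hEH hxw)⟩, ?_⟩
    rintro ⟨y, w'⟩ ⟨hyS, hyw⟩
    obtain hw' | ⟨-, w'', rfl, hw''⟩ :=
      isDiWalk_of_edgeSet_eq_insert hor hE ht hh hyw (hH.1 hyS)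
    · exact absurd (mem_vertexSet_of_isDiWalk hw') hh
    · obtain ⟨rfl, rfl⟩ := Prod.mk.inj (huniq (y, w'') ⟨hyS, hw''⟩)
      rfl
  · obtain ⟨⟨x, w⟩, ⟨hxS, hxw⟩, huniq⟩ := hH.2 u hu
    refine ⟨(x, w), ⟨hxS, isDiWalk_mono hVH hEH hxw⟩, ?_⟩
    rintro ⟨y, w'⟩ ⟨hyS, hyw⟩
    obtain hw' | ⟨rfl, -⟩ := isDiWalk_of_edgeSet_eq_insert hor hE ht hh hyw (hH.1 hyS)
    · exact huniq (y, w') ⟨hyS, hw'⟩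
    · exact absurd hu hh

lemma edgeSet_induce_restrict {W : Set α} {F : Set β}
    (hlink : ∀ e ∈ F, G.IsLink e (tail e) (head e)) (hends : ∀ e ∈ F, tail e ∈ W ∧ head e ∈ W) :
    E((G.restrict F).induce W) = F := by
  ext e
  refine ⟨fun he ↦ ?_, fun he ↦ ⟨_, _, ⟨he, hlink e he⟩, hends e he⟩⟩
  obtain ⟨x, y, hxy, -⟩ := he
  exact hxy.1

lemma isOrientation_induce_restrict {W : Set α} {F : Set β}
    (hlink : ∀ e ∈ F, G.IsLink e (tail e) (head e)) (hends : ∀ e ∈ F, tail e ∈ W ∧ head e ∈ W) :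
    ((G.restrict F).induce W).IsOrientation tail head := fun e he ↦ by
  have heF := (edgeSet_induce_restrict hlink hends).subset he
  exact ⟨⟨heF, hlink e heF⟩, hends e heF⟩

variable [DecidableEq α] [DecidableEq β] {W : Finset α} {F : Finset β}

lemma IsGrown.ends_mem (hW : IsGrown tail head S W F) : ∀ e ∈ F, tail e ∈ W ∧ head e ∈ W := by
  induction hW with
  | base => simp
  | step e _ ht _ _ ih => grind

lemma IsGrown.isBranching_induce_restrict (hW : IsGrown tail head S W F)
    (hlink : ∀ e ∈ F, G.IsLink e (tail e) (head e)) :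
    ((G.restrict F).induce W).IsBranching tail head S := by
  have hE := edgeSet_induce_restrict hlink hW.ends_mem
  induction hW with
  | base => exact isBranching_of_edgeSet_eq_empty rfl (by simpa using hE)
  | @step W F e hW ht hh _ ih =>
    have hlinkF : ∀ f ∈ F, G.IsLink f (tail f) (head f) := fun f hf ↦
      hlink f (mem_insert_of_mem hf)
    have hEF := edgeSet_induce_restrict hlinkF hW.ends_mem
    refine isBranching_of_edgeSet_eq_insert (ih hlinkF hEF)
      (isOrientation_induce_restrict hlinkF hW.ends_mem) (coe_insert _ _) ?_ ht hh
    rw [hE, hEF, coe_insert]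

end Branching

section GraphPacking

variable {V E : Type*} {α β κ : Type*} [DecidableEq V] [DecidableEq E] [DecidableEq α]
  [DecidableEq β]

lemma IsGrown.map {tail head : E → V} {tail' head' : β → α} {S W : Finset V} {F : Finset E}
    (hW : IsGrown tail head S W F) (f : V ↪ α) (g : E ↪ β) (ht : ∀ e, tail' (g e) = f (tail e))
    (hh : ∀ e, head' (g e) = f (head e)) : IsGrown tail' head' (S.map f) (W.map f) (F.map g) := by
  induction hW with
  | base => exact .base
  | step e _ htW hhW heF ih =>
    rw [map_insert, map_insert, ← hh]
    exact ih.step (g e) (ht e ▸ mem_map_of_mem f htW) (by simpa [hh] using hhW)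
      (by simpa using heF)

lemma IsGrownPacking.map {tail head : E → V} {tail' head' : β → α} {S W : κ → Finset V}
    {F : κ → Finset E} (hW : IsGrownPacking tail head S W F) (f : V ↪ α) (g : E ↪ β)
    (ht : ∀ e, tail' (g e) = f (tail e)) (hh : ∀ e, head' (g e) = f (head e)) :
    IsGrownPacking tail' head' (fun i ↦ (S i).map f) (fun i ↦ (W i).map f)
      fun i ↦ (F i).map g where
  isGrown i := (hW.isGrown i).map f g ht hh
  disjoint _ _ hij := (disjoint_map g).2 (hW.disjoint hij)

lemma IsGrownPacking.isRegularForestPacking {G : Graph α β} {tail head : β → α} {h k : ℕ}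
    {S W : Fin k → Finset α} {F : Fin k → Finset β} (hW : IsGrownPacking tail head S W F)
    (hWG : ∀ i, (W i : Set α) ⊆ V(G)) (hlink : ∀ i, ∀ e ∈ F i, G.IsLink e (tail e) (head e))
    (hreg : ∀ v ∈ V(G), #(colours W v) = h) :
    G.IsRegularForestPacking h (fun i ↦ (G.restrict (F i)).induce (W i)) S where
  le i := (Graph.induce_le (G := G.restrict (F i)) (hWG i)).trans Graph.restrict_le
  isRootedForest i := ⟨tail, head,
    isOrientation_induce_restrict (hlink i) (hW.isGrown i).ends_mem,
    (hW.isGrown i).isBranching_induce_restrict (hlink i)⟩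
  edgeDisjoint i j hij := by
    rw [edgeSet_induce_restrict (hlink i) (hW.isGrown i).ends_mem,
      edgeSet_induce_restrict (hlink j) (hW.isGrown j).ends_mem]
    exact disjoint_coe.2 (hW.disjoint hij)
  regular v hv := by
    rw [← hreg v hv, ← Set.ncard_coe_finset]
    congr 1
    ext i
    simp [mem_colours]

end GraphPacking

section Fibres

variable {α β γ : Type*}

/-- The partition of `U` into the nonempty fibres of a map on `U`. -/
def fibrePartition {U : Set α} (φ : U → γ) : Partition U where
  parts := (fun c ↦ Subtype.val '' (φ ⁻¹' {c})) '' Set.range φ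
  sSupIndep' := by
    rw [sSupIndep_iff_pairwiseDisjoint]
    rintro _ ⟨c, -, rfl⟩ _ ⟨d, -, rfl⟩ hne
    exact (Set.disjoint_image_iff Subtype.val_injective).2 <|
      (Set.disjoint_singleton.2 fun hcd ↦ hne (by rw [hcd])).preimage φ
  bot_notMem' := by
    rintro ⟨_, ⟨v, rfl⟩, hv⟩
    exact Set.notMem_empty (v : α) (hv.subset ⟨v, rfl, rfl⟩)
  sSup_eq' := by
    rw [Set.sSup_eq_sUnion, Set.sUnion_image, ← Set.image_iUnion₂, Set.biUnion_preimage_singleton,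
      Set.preimage_range, Set.image_univ, Subtype.range_coe]

lemma ncard_fibrePartition {U : Set α} (φ : U → γ) :
    (fibrePartition φ).parts.ncard = (Set.range φ).ncard := by
  refine Set.InjOn.ncard_image fun c hc d hd hcd ↦ Set.singleton_injective ?_
  exact (Set.preimage_eq_preimage' (Set.singleton_subset_iff.2 hc)
    (Set.singleton_subset_iff.2 hd)).1 (Set.image_injective.2 Subtype.val_injective hcd)

lemma numCrossing_fibrePartition_le {G : Graph α β} [DecidableEq γ] [Fintype E(G)] (φ : V(G) → γ)
    {a b : E(G) → V(G)} (hab : ∀ e : E(G), G.IsLink e (a e) (b e)) :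
    G.numCrossing (fibrePartition φ) ≤ #{e | φ (a e) ≠ φ (b e)} := by
  rw [← card_map (.subtype _), ← Set.ncard_coe_finset]
  refine Set.ncard_le_ncard ?_ (finite_toSet _)
  rintro e ⟨_, ⟨c, -, rfl⟩, x, y, hxy, ⟨x, rfl, rfl⟩, hy⟩
  lift y to V(G) using hxy.right_mem
  lift e to E(G) using hxy.edge_mem
  have hne : φ x ≠ φ y := fun h_eq ↦ hy ⟨y, h_eq.symm, rfl⟩
  refine mem_coe.2 (mem_map_of_mem (.subtype _) (mem_filter.2 ⟨mem_univ _, ?_⟩))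
  obtain ⟨ha, hb⟩ | ⟨ha, hb⟩ := (hab e).eq_and_eq_or_eq_and_eq hxy
  · rwa [Subtype.ext ha, Subtype.ext hb]
  · rwa [Subtype.ext ha, Subtype.ext hb, ne_comm]

end Fibres

section Existence

variable {α β : Type*} {G : Graph α β}

lemma partitionCondition_of_forall_partition [Fintype V(G)] [Fintype E(G)] [DecidableEq V(G)]
    {κ : Type*} [Fintype κ] {h : ℕ} {s : κ → ℕ} {a b : E(G) → V(G)}
    (hab : ∀ e : E(G), G.IsLink e (a e) (b e))
    (hP : ∀ P : Partition V(G),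
      h * P.parts.ncard ≤ ∑ i, min (s i) P.parts.ncard + G.numCrossing P) :
    PartitionCondition a b h s := by
  intro φ
  have hcut := hP (fibrePartition φ)
  rw [ncard_fibrePartition, ← Set.image_univ, ← coe_univ, ← coe_image, Set.ncard_coe_finset] at hcut
  exact hcut.trans (Nat.add_le_add_left (numCrossing_fibrePartition_le φ hab) _)

variable [Nonempty α]

lemma IsGrownPacking.exists_isRegularForestPacking [DecidableEq V(G)] [DecidableEq E(G)] {h k : ℕ}
    {tail head : E(G) → V(G)} {S W : Fin k → Finset V(G)} {F : Fin k → Finset E(G)}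
    (hW : IsGrownPacking tail head S W F) (hlink : ∀ e : E(G), G.IsLink e (tail e) (head e))
    (hreg : ∀ v, #(colours W v) = h) :
    ∃ B : Fin k → Graph α β,
      G.IsRegularForestPacking h B fun i ↦ (S i).map (.subtype (· ∈ V(G))) := by
  classical
  let x₀ := Classical.arbitrary α
  let tail' := Function.extend Subtype.val (fun e ↦ (tail e : α)) fun _ ↦ x₀
  let head' := Function.extend Subtype.val (fun e ↦ (head e : α)) fun _ ↦ x₀
  have ht (e : E(G)) : tail' e = tail e := Subtype.val_injective.extend_apply ..
  have hh (e : E(G)) : head' e = head e := Subtype.val_injective.extend_apply ..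
  refine ⟨_, (hW.map (.subtype _) (.subtype _) ht hh).isRegularForestPacking
    (fun i x hx ↦ ?_) (fun i e he ↦ ?_) fun v hv ↦ ?_⟩
  · obtain ⟨x, -, rfl⟩ := mem_map.1 hx
    exact x.2
  · obtain ⟨e, -, rfl⟩ := mem_map.1 he
    rw [Function.Embedding.subtype_apply, ht, hh]
    exact hlink e
  · rw [← hreg ⟨v, hv⟩]
    congr 1
    ext i
    simp [mem_colours, hv]

theorem exists_isRegularForestPacking (hV : V(G).Finite) (hE : E(G).Finite) {h k : ℕ}
    {s : Fin k → ℕ} (hs : ∀ i, s i ≤ V(G).ncard) (hsum : ∑ i, s i ≤ h * V(G).ncard)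
    (hP : ∀ P : Partition V(G),
      h * P.parts.ncard ≤ ∑ i, min (s i) P.parts.ncard + G.numCrossing P) :
    ∃ (B : Fin k → Graph α β) (S : Fin k → Finset α),
      G.IsRegularForestPacking h B S ∧ ∀ i, #(S i) = s i := by
  classical
  have := hV.fintype
  have := hE.fintype
  have hends (e : E(G)) : ∃ x y : V(G), G.IsLink e x y := by
    obtain ⟨x, y, hxy⟩ := Graph.exists_isLink_of_mem_edgeSet e.2
    exact ⟨⟨x, hxy.left_mem⟩, ⟨y, hxy.right_mem⟩, hxy⟩
  choose a b hab using hends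
  rw [← Nat.card_coe_set_eq, Nat.card_eq_fintype_card] at hsum
  simp only [← Nat.card_coe_set_eq V(G), Nat.card_eq_fintype_card] at hs
  obtain ⟨tail, head, S, W, F, hor, hS, hW, hreg⟩ :=
    (partitionCondition_of_forall_partition hab hP).exists_isGrownPacking hs hsum
  have hlink (e : E(G)) : G.IsLink e (tail e) (head e) := by
    obtain ⟨ht, hh⟩ | ⟨ht, hh⟩ := Sym2.eq_iff.1 (hor e)
    · exact ht ▸ hh ▸ hab e
    · exact ht ▸ hh ▸ (hab e).symm
  obtain ⟨B, hB⟩ := hW.exists_isRegularForestPacking hlink hreg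
  exact ⟨B, _, hB, fun i ↦ by rw [card_map, hS]⟩

end Existence

section Necessity

variable {α β : Type*} {G H : Graph α β}

lemma ncard_parts_le {U : Set α} (hU : U.Finite) (P : Partition U) :
    P.parts.ncard ≤ U.ncard := by
  have hparts : P.parts ⊆ P.partOf '' U := fun X hX ↦ Partition.mem_iff_exists_partOf.1 hX
  exact (Set.ncard_le_ncard hparts (hU.image _)).trans (Set.ncard_image_le hU)

lemma card_le_card_of_forall_exists_mem {𝒬 : Finset (Set α)}
    (h𝒬 : (𝒬 : Set (Set α)).PairwiseDisjoint id) {ι : Type*} {T : Finset ι} (f : ι → α)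
    (hT : ∀ X ∈ 𝒬, ∃ i ∈ T, f i ∈ X) : #𝒬 ≤ #T :=
  card_le_card_of_forall_subsingleton (fun X i ↦ f i ∈ X) hT
    fun _ _ _ hX _ hY ↦ h𝒬.elim_set hX.1 hY.1 _ hX.2 hY.2

lemma card_le_card_roots_add_card_crossing {S : Finset α} (hH : H.IsRootedForest S)
    {𝒬 : Finset (Set α)} (h𝒬 : (𝒬 : Set (Set α)).PairwiseDisjoint id)
    (hmeet : ∀ X ∈ 𝒬, (V(H) ∩ X).Nonempty) {K : Finset β}
    (hK : ∀ X ∈ 𝒬, ∀ e x y, H.IsLink e x y → x ∈ X → y ∉ X → e ∈ K) : #𝒬 ≤ #S + #K := by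
  classical
  obtain ⟨tail, head, hor, -, hbr⟩ := hH
  have hroots : #{X ∈ 𝒬 | ∃ x ∈ S, x ∈ X} ≤ #S :=
    card_le_card_of_forall_exists_mem (h𝒬.subset (filter_subset _ _)) id
      fun X hX ↦ (mem_filter.1 hX).2
  have harcs : #{X ∈ 𝒬 | ¬∃ x ∈ S, x ∈ X} ≤ #K := by
    refine card_le_card_of_forall_exists_mem (h𝒬.subset (filter_subset _ _)) head fun X hX ↦ ?_
    obtain ⟨hX𝒬, hXS⟩ := mem_filter.1 hX
    obtain ⟨v, hvH, hvX⟩ := hmeet X hX𝒬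
    obtain ⟨⟨x, w⟩, ⟨hxS, hw⟩, -⟩ := hbr v hvH
    obtain ⟨e, he, ht, hh⟩ := exists_entering_of_isDiWalk hw (fun hxX ↦ hXS ⟨x, hxS, hxX⟩) hvX
    exact ⟨e, hK X hX𝒬 e _ _ (hor e he).symm hh ht, hh⟩
  rw [← card_filter_add_card_filter_not fun X ↦ ∃ x ∈ S, x ∈ X]
  exact Nat.add_le_add hroots harcs

variable {h k : ℕ} {B : Fin k → Graph α β} {S : Fin k → Finset α}

open Classical in
lemma card_filter_mem_vertexSet (hB : G.IsRegularForestPacking h B S) {v : α} (hv : v ∈ V(G)) :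
    #{i | v ∈ V(B i)} = h := by
  rw [← hB.regular v hv, ← Set.ncard_coe_finset]
  simp

lemma sum_card_roots_le (hB : G.IsRegularForestPacking h B S) (hV : V(G).Finite) :
    ∑ i, #(S i) ≤ h * V(G).ncard := by
  classical
  have hroots (i : Fin k) : S i ⊆ {v ∈ hV.toFinset | v ∈ V(B i)} := fun x hx ↦ by
    obtain ⟨tail, head, -, hS, -⟩ := hB.isRootedForest i
    exact mem_filter.2 ⟨hV.mem_toFinset.2 ((hB.le i).vertexSet_mono (hS hx)), hS hx⟩
  calc ∑ i, #(S i) ≤ ∑ i, #{v ∈ hV.toFinset | v ∈ V(B i)} :=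
        sum_le_sum fun i _ ↦ card_le_card (hroots i)
    _ = ∑ v ∈ hV.toFinset, #{i | v ∈ V(B i)} :=
        sum_card_bipartiteAbove_eq_sum_card_bipartiteBelow _
    _ = ∑ _ ∈ hV.toFinset, h :=
        sum_congr rfl fun v hv ↦ card_filter_mem_vertexSet hB (hV.mem_toFinset.1 hv)
    _ = h * V(G).ncard := by
        rw [sum_const, smul_eq_mul, mul_comm, Set.ncard_eq_toFinset_card _ hV]

lemma sum_card_filter_edgeSet_le [∀ i, DecidablePred (· ∈ E(B i))]
    (hB : G.IsRegularForestPacking h B S) (K : Finset β) :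
    ∑ i, #{e ∈ K | e ∈ E(B i)} ≤ #K := by
  classical
  rw [← card_biUnion]
  · exact card_le_card (biUnion_subset.2 fun i _ ↦ filter_subset _ _)
  · exact fun i _ j _ hij ↦ disjoint_filter.2 fun e _ hei hej ↦
      Set.disjoint_left.1 (hB.edgeDisjoint i j hij) hei hej

lemma mul_ncard_parts_le (hB : G.IsRegularForestPacking h B S) (hV : V(G).Finite)
    (hE : E(G).Finite) (P : Partition V(G)) :
    h * P.parts.ncard ≤ ∑ i, min #(S i) P.parts.ncard + G.numCrossing P := by
  classical
  have hPfin : P.parts.Finite := hV.finite_subsets.subset fun X hX ↦ P.subset_of_mem hX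
  have hKfin : {e : β | ∃ X ∈ P.parts, ∃ x y, G.IsLink e x y ∧ x ∈ X ∧ y ∉ X}.Finite :=
    hE.subset fun e ⟨_, _, _, _, hl, _⟩ ↦ hl.edge_mem
  unfold Graph.numCrossing
  rw [Set.ncard_eq_toFinset_card _ hPfin, Set.ncard_eq_toFinset_card _ hKfin]
  set parts := hPfin.toFinset
  set K := hKfin.toFinset
  have hmem {X : Set α} (hX : X ∈ parts) : X ∈ P := hPfin.mem_toFinset.1 hX
  have hreg (X) (hX : X ∈ parts) : h ≤ #{i | (V(B i) ∩ X).Nonempty} := by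
    obtain ⟨v, hv⟩ := P.nonempty_of_mem (hmem hX)
    rw [← card_filter_mem_vertexSet hB (P.subset_of_mem (hmem hX) hv)]
    exact card_le_card (monotone_filter_right _ fun i _ hi ↦ ⟨v, hi, hv⟩)
  have hforest (i : Fin k) : #{X ∈ parts | (V(B i) ∩ X).Nonempty} ≤
      min #(S i) #parts + #{e ∈ K | e ∈ E(B i)} := by
    have hcount := card_le_card_roots_add_card_crossing (hB.isRootedForest i)
      (𝒬 := {X ∈ parts | (V(B i) ∩ X).Nonempty}) (K := {e ∈ K | e ∈ E(B i)})
      (P.pairwiseDisjoint.subset fun X hX ↦ hmem (mem_filter.1 hX).1)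
      (fun X hX ↦ (mem_filter.1 hX).2)
      fun X hX e x y hxy hx hy ↦ mem_filter.2 ⟨hKfin.mem_toFinset.2
        ⟨X, hmem (mem_filter.1 hX).1, x, y, hxy.mono (hB.le i), hx, hy⟩, hxy.edge_mem⟩
    have := card_filter_le parts fun X ↦ (V(B i) ∩ X).Nonempty
    omega
  calc h * #parts = ∑ _ ∈ parts, h := by rw [sum_const, smul_eq_mul, mul_comm]
    _ ≤ ∑ X ∈ parts, #{i | (V(B i) ∩ X).Nonempty} := sum_le_sum hreg
    _ = ∑ i, #{X ∈ parts | (V(B i) ∩ X).Nonempty} :=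
        (sum_card_bipartiteAbove_eq_sum_card_bipartiteBelow _).symm
    _ ≤ ∑ i, (min #(S i) #parts + #{e ∈ K | e ∈ E(B i)}) := sum_le_sum fun i _ ↦ hforest i
    _ ≤ ∑ i, min #(S i) #parts + #K := by
        rw [sum_add_distrib]
        exact Nat.add_le_add_left (sum_card_filter_edgeSet_le hB K) _

lemma sum_min_add_sum_le {ι : Type*} [Fintype ι] {l s : ι → ℕ} (n : ℕ) (hls : ∀ i, l i ≤ s i) :
    ∑ i, min (s i) n + ∑ i, l i ≤ ∑ i, s i + ∑ i, min (l i) n := by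
  rw [← sum_add_distrib, ← sum_add_distrib]
  exact sum_le_sum fun i _ ↦ by
    have := hls i
    omega

end Necessity

end ForestPacking

theorem mainTheorem2 {α β : Type*} (G : Graph α β) (hV : V(G).Finite) (hE : E(G).Finite)
    (h k : ℕ) (hh : 0 < h) (hk : 0 < k)
    (l l' : Fin (k + 1) → ℕ) (hl : ∀ i, 0 < l i) (hl' : ∀ i, 0 < l' i)
    (h₁ : l' 0 ≤ ∑ i : Fin k, l' i.succ) (h₂ : l 0 ≤ l' 0) (h₃ : ∑ i : Fin k, l i.succ ≤ l 0)
    (h₄ : ∀ i : Fin k, l' i.succ ≤ V(G).ncard) (h₅ : ∀ i : Fin k, l i.succ ≤ l' i.succ) :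
    (∃ (B : Fin k → Graph α β) (S : Fin k → Finset α),
        G.IsRegularForestPacking h B S ∧
        (∀ i : Fin k, l i.succ ≤ (S i).card ∧ (S i).card ≤ l' i.succ) ∧
        l 0 ≤ ∑ i : Fin k, (S i).card ∧ ∑ i : Fin k, (S i).card ≤ l' 0) ↔
      (l 0 ≤ h * V(G).ncard ∧
        (∀ P : Partition V(G),
          (h : ℤ) * P.parts.ncard ≤
            (l' 0 : ℤ) - (∑ i : Fin k, (l i.succ : ℤ))
              + (∑ i : Fin k, min (l i.succ : ℤ) P.parts.ncard) + G.numCrossing P) ∧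
        (∀ P : Partition V(G),
          h * P.parts.ncard ≤
            (∑ i : Fin k, min (l' i.succ) P.parts.ncard) + G.numCrossing P)) := by
  constructor
  · rintro ⟨B, S, hB, hS, hlower, hupper⟩
    have hcount := ForestPacking.mul_ncard_parts_le hB hV hE
    refine ⟨hlower.trans (ForestPacking.sum_card_roots_le hB hV), fun P ↦ ?_, fun P ↦ ?_⟩
    · have hmin := ForestPacking.sum_min_add_sum_le P.parts.ncard fun i ↦ (hS i).1
      have := hcount P
      zify at this hmin hupper
      linarith
    · exact (hcount P).trans <| Nat.add_le_add_right
        (Finset.sum_le_sum fun i _ ↦ min_le_min_right _ (hS i).2) _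
  · rintro ⟨hn, hlow, hup⟩
    have : Nonempty α := (Set.nonempty_of_ncard_ne_zero
      ((hl' _).trans_le (h₄ ⟨0, hk⟩)).ne').to_type
    obtain ⟨s, hls, hsl', hsum, hs⟩ := ForestPacking.exists_root_counts
      (ForestPacking.ncard_parts_le hV) h₅ h₄ h₃ h₂ h₁ hn
      (fun P ↦ by
        have := hlow P
        zify
        linarith) hup
    obtain ⟨B, S, hB, hS⟩ := ForestPacking.exists_isRegularForestPacking hV hE
      (fun i ↦ (hsl' i).trans (h₄ i)) (hsum.trans_le (min_le_right _ _)) hs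
    refine ⟨B, S, hB, ?_⟩
    simp only [hS, hsum]
    exact ⟨fun i ↦ ⟨hls i, hsl' i⟩, le_min h₂ hn, min_le_left _ _⟩
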